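/- Let $d\ge 2$ and let $\mathbb Z^d$ carry its nearest-neighbour structure $\sim$. For a finite $\Lambda\subset\mathbb Z^d$ with external boundary $\partial\Lambda=\{y\notin\Lambda:\exists x\in\Lambda,\ x\sim y\}$, $n\in\mathbb Z$ and $\phi:\Lambda\to\mathbb Z$ let $$\mathcal H^n_\Lambda(\phi)=\frac12\sum_{x,y\in\Lambda,\ x\sim y}|\phi(x)-\phi(y)|+\sum_{x\in\Lambda,\ y\in\partial\Lambda,\ x\sim y}|\phi(x)-n|,$$ and for $\beta>0$, $h\in\mathbb R$ let $$\mathcal Z^n_{\Lambda,\beta}=\sum_{\phi:\Lambda\to\mathbb Z}e^{-\beta\mathcal H^n_\Lambda(\phi)},\qquad \mathcal Z^{n,h}_{\Lambda,\beta}=\sum_{\phi:\Lambda\to\mathbb Z}e^{-\beta\mathcal H^n_\Lambda(\phi)+h|\{x\in\Lambda:\phi(x)=0\}|}.$$ With $\Lambda_N=\{1,\dots,N\}^d$ set $$\mathrm f(\beta)=\lim_{N\to\infty}\frac{1}{N^d}\log\mathcal Z^n_{\Lambda_N,\beta},\qquad \mathrm f(\beta,h)=\lim_{N\to\infty}\frac1{N^d}\log\mathcal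 Z^{n,h}_{\Lambda_N,\beta},$$ $$\bar{\mathrm f}_\beta(h)=\mathrm f(\beta,h)-\mathrm f(\beta),\qquad h_c(\beta)=\inf\{h\in\mathbb R:\bar{\mathrm f}_\beta(h)>0\}.$$ Let $\mathbf E_{\Lambda,\beta}$ be the expectation under the probability measure on $\mathbb Z^\Lambda$ proportional to $e^{-\beta\mathcal H^0_\Lambda}$. Call $\beta_0>0$ a rigidity threshold if there is $c>0$ such that for every $\beta>\beta_0$ there is a probability measure $\mathbf P_\beta$ on $\mathbb Z^{\mathbb Z^d}$, with expectation $\mathbf E_\beta$, such that for every non-empty finite $A\subset\mathbb Z^d$, every function $f$ with values in $[0,1]$ of the heights $(\phi(x))_{x\in A}$, and every finite $\Lambda\supset A$, $$|\mathbf E_{\Lambda,\beta}[f(\phi)]-\mathbf E_\beta[f(\phi)]|\le |A|\,e^{-c\beta d(\partial\Lambda,A)},$$ where $d(\cdot,\cdot)$ is the $\ell_1$ distance between sets. **Proposition.** The following holds for all $\beta\ge\beta_0$ whenever $\beta_0$ is a rigidity threshold, and it also holds (without reference to rigidity thresholds) for all $\beta\ge b$, for some constant $b>0$ depending only on $d$.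 The limits that define $\mathrm f(\beta)$ and $\mathrm f(\beta,h)$ exist for all $h\in\mathbb R$ and $n\in\mathbb Z$ and do not depend on $n$; $h_c(\beta)=0$; and there is a constant $c_\beta>0$ such that $$\bar{\mathrm f}_\beta(h)\sim c_\beta h\qquad\text{as } h\to0+.$$ Moreover the transition is of first order: $\bar{\mathrm f}_\beta$ is not differentiable at $h_c(\beta)=0$. -/

import Mathlib

namespace SOS

/-- The `ℓ¹` distance on `ℤ^d`. -/
def l1dist {d : ℕ} (x y : Fin d → ℤ) : ℕ := ∑ i, (x i - y i).natAbs

/-- Nearest neighbours in the lattice `ℤ^d`. -/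
def Adj {d : ℕ} (x y : Fin d → ℤ) : Prop := l1dist x y = 1

instance {d : ℕ} (x y : Fin d → ℤ) : Decidable (Adj x y) :=
  inferInstanceAs (Decidable (l1dist x y = 1))

/-- The external boundary `∂Λ` of a finite set `Λ ⊂ ℤ^d`; see `mem_boundary`. -/
noncomputable def boundary {d : ℕ} (Λ : Finset (Fin d → ℤ)) : Finset (Fin d → ℤ) :=
  (Λ.biUnion fun x => (Finset.Icc (x - 1) (x + 1)).filter fun y => Adj x y) \ Λ

theorem mem_boundary {d : ℕ} (Λ : Finset (Fin d → ℤ)) (y : Fin d → ℤ) :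
    y ∈ boundary Λ ↔ y ∉ Λ ∧ ∃ x ∈ Λ, Adj x y := by
  have key : ∀ x : Fin d → ℤ, Adj x y → y ∈ Finset.Icc (x - 1) (x + 1) := by
    intro x h
    have hi : ∀ i, (x i - y i).natAbs ≤ 1 := fun i =>
      le_of_le_of_eq (Finset.single_le_sum (f := fun i => (x i - y i).natAbs)
        (fun _ _ => Nat.zero_le _) (Finset.mem_univ i)) h
    rw [Finset.mem_Icc, Pi.le_def, Pi.le_def]
    constructor <;> intro i <;> have := hi i <;>
      simp only [Pi.sub_apply, Pi.add_apply, Pi.one_apply] <;> omega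
  simp only [boundary, Finset.mem_sdiff, Finset.mem_biUnion, Finset.mem_filter]
  constructor
  · rintro ⟨⟨x, hx, -, h⟩, hy⟩
    exact ⟨hy, x, hx, h⟩
  · rintro ⟨hy, x, hx, h⟩
    exact ⟨⟨x, hx, key x h, h⟩, hy⟩

/-- The solid-on-solid Hamiltonian on `Λ` with boundary condition `n`. -/
noncomputable def hamiltonian {d : ℕ} (Λ : Finset (Fin d → ℤ)) (n : ℤ) (φ : Λ → ℤ) : ℝ :=
  (1 / 2 : ℝ) * (∑ x : Λ, ∑ y : Λ, if Adj x.1 y.1 then |(φ x : ℝ) - (φ y : ℝ)| else 0)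
    + ∑ x : Λ, ∑ y ∈ boundary Λ, if Adj x.1 y then |(φ x : ℝ) - (n : ℝ)| else 0

/-- The number of sites of `Λ` at height `0`. -/
def contacts {d : ℕ} {Λ : Finset (Fin d → ℤ)} (φ : Λ → ℤ) : ℕ :=
  (Finset.univ.filter fun x => φ x = 0).card

/-- The partition function of the model without interaction (boundary condition `n`).
For `β > 0` and `d ≥ 1` the series converges. -/
noncomputable def partitionSOS {d : ℕ} (Λ : Finset (Fin d → ℤ)) (β : ℝ) (n : ℤ) : ℝ :=
  ∑' φ : Λ → ℤ, Real.exp (-β * hamiltonian Λ n φ)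

/-- The partition function of the model with homogeneous interaction of intensity `h` at
level `0` (boundary condition `n`). -/
noncomputable def partition {d : ℕ} (Λ : Finset (Fin d → ℤ)) (β : ℝ) (n : ℤ) (h : ℝ) : ℝ :=
  ∑' φ : Λ → ℤ, Real.exp (-β * hamiltonian Λ n φ + h * (contacts φ : ℝ))

/-- The box `{1, …, N}^d`. -/
noncomputable def box (d N : ℕ) : Finset (Fin d → ℤ) := Finset.Icc (fun _ => 1) (fun _ => (N : ℤ))

/-- The free energy of the model without interaction. -/
noncomputable def freeEnergySOS (d : ℕ) (β : ℝ) : ℝ :=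
  Filter.limUnder Filter.atTop
    fun N : ℕ => Real.log (partitionSOS (box d N) β 0) / (N : ℝ) ^ d

/-- The free energy of the model with homogeneous interaction. -/
noncomputable def freeEnergy (d : ℕ) (β h : ℝ) : ℝ :=
  Filter.limUnder Filter.atTop
    fun N : ℕ => Real.log (partition (box d N) β 0 h) / (N : ℝ) ^ d

/-- The free energy difference produced by the interaction. -/
noncomputable def reducedFreeEnergy (d : ℕ) (β h : ℝ) : ℝ :=
  freeEnergy d β h - freeEnergySOS d β

/-- The critical point `inf {h ∈ ℝ : reduced free energy > 0}`, as an extended real number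
(so that it is `⊤` if the set is empty and `⊥` if it is not bounded below). -/
noncomputable def criticalPoint (d : ℕ) (β : ℝ) : EReal :=
  sInf {u : EReal | ∃ h : ℝ, u = (h : EReal) ∧ 0 < reducedFreeEnergy d β h}

/-- The extension of a configuration on `Λ` to `ℤ^d` by the boundary value `0`. -/
def extend {d : ℕ} {Λ : Finset (Fin d → ℤ)} (φ : Λ → ℤ) : (Fin d → ℤ) → ℤ :=
  fun x => if hx : x ∈ Λ then φ ⟨x, hx⟩ else 0

/-- The expectation of `f` under the solid-on-solid measure on `Λ` with boundary condition `0`. -/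
noncomputable def expectation {d : ℕ} (Λ : Finset (Fin d → ℤ)) (β : ℝ)
    (f : ((Fin d → ℤ) → ℤ) → ℝ) : ℝ :=
  (∑' φ : Λ → ℤ, f (extend φ) * Real.exp (-β * hamiltonian Λ 0 φ)) / partitionSOS Λ β 0

/-- The `ℓ¹` distance between two finite sets (a minimum if both are non-empty). -/
noncomputable def setDist {d : ℕ} (A B : Finset (Fin d → ℤ)) : ℕ :=
  sInf {k : ℕ | ∃ x ∈ A, ∃ y ∈ B, k = l1dist x y}

/-- `β₀` is a rigidity threshold: for `β > β₀` the finite volume measures with boundary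
condition `0` converge exponentially fast, on functions of finitely many heights, to a
probability measure on `ℤ^(ℤ^d)`.  (As the right-hand side is monotone in `A`, asking for
this for all `f` depending on the heights in `A` only, or for all `f` whose support is exactly
`A`, is the same. Such an `f` is automatically measurable.) -/
def IsRigidityThreshold (d : ℕ) (β₀ : ℝ) : Prop :=
  0 < β₀ ∧ ∃ c : ℝ, 0 < c ∧ ∀ β : ℝ, β₀ < β →
    ∃ P : MeasureTheory.Measure ((Fin d → ℤ) → ℤ), MeasureTheory.IsProbabilityMeasure P ∧
      ∀ (A : Finset (Fin d → ℤ)) (f : ((Fin d → ℤ) → ℤ) → ℝ), A.Nonempty →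
        (∀ φ, f φ ∈ Set.Icc (0 : ℝ) 1) → DependsOn f (A : Set (Fin d → ℤ)) →
        ∀ Λ : Finset (Fin d → ℤ), A ⊆ Λ →
          |expectation Λ β f - ∫ φ, f φ ∂P|
            ≤ (A.card : ℝ) * Real.exp (-(c * β * (setDist (boundary Λ) A : ℝ)))

end SOS

/-! The argument compares boundary conditions. Changing the boundary height from `n` to `0` costs at
most `β |n|` per boundary pair, which is negligible against the volume of a box, so any fixed `n`
may be used to bound the free energy from below. Existence of the limits follows from
superadditivity: gluing configurations on disjoint sets does not raise the total energy
(`partition_mul_le`), and a Fekete argument on boxes applies (`exists_tendsto_div_pow`).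

Jensen's inequality bounds the gain in free energy below by `h` times the density of contacts
without interaction (`log_partition_ge`). By translation of heights, contacts with boundary
condition `n` are sites at height `-n` with boundary condition `0`. Summed over `|n| ≤ K` they give
the expected number of sites of height at most `K` in absolute value (`sum_meanContacts`). For `h <
0` some such `n` has contact density at most `1 / (K + 1)`; letting `K` grow gives a non-negative
free energy difference, hence zero by monotonicity (`reducedFreeEnergy_nonneg`). For `h > 0`, if
heights in the bulk stay bounded with probability bounded below (`IsTight`), some `n` has a positive
contact density, which gives a bound `κ h` with `κ > 0` (`IsTight.exists_mul_le`). Convexity makes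
the ratio of the free energy difference to `h` monotone for `h > 0`, so it converges as `h → 0+`;
the one-sided slopes at `0` differ.

Tightness has two sources. Under rigidity, the law of a height deep inside any box is close to that
at the centre of one fixed box, and continuity in `β` includes the threshold itself
(`IsRigidityThreshold.isTight`). For large `β` it is a Peierls estimate (`tsum_pos_height_le`):
around a positive height there is an island of minimal boundary; that boundary is connected through
plaquettes, so such contours grow at most exponentially in number with their length, and lowering
the island by one gains energy equal to this length. -/

namespace SOS

open Finset

variable {d : ℕ}

/-! ### Lattice edges and the Hamiltonian. -/

/-- The `i`-th coordinate vector of `ℤ^d`. -/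
abbrev unitVec (i : Fin d) : Fin d → ℤ := Pi.single i 1

theorem unitVec_injective : Function.Injective (unitVec : Fin d → Fin d → ℤ) := by
  intro i j h
  by_contra hij
  have := congrFun h i
  simp [unitVec, Pi.single_eq_of_ne hij] at this

theorem add_unitVec_inj {x : Fin d → ℤ} {i j : Fin d} :
    x + unitVec i = x + unitVec j ↔ i = j :=
  ⟨fun h => unitVec_injective (add_left_cancel h), fun h => h ▸ rfl⟩

theorem ne_add_unitVec_add_unitVec (x : Fin d → ℤ) (i j : Fin d) :
    x ≠ x + unitVec i + unitVec j := by
  intro h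
  have := congrFun h i
  by_cases hij : i = j
  · subst hij; simp [unitVec] at this; omega
  · simp [unitVec, Pi.single_eq_of_ne hij] at this

theorem adj_symm {x y : Fin d → ℤ} (h : Adj x y) : Adj y x := by
  unfold Adj l1dist at *
  rw [← h]
  exact sum_congr rfl fun i _ => by omega

theorem adj_comm {x y : Fin d → ℤ} : Adj x y ↔ Adj y x := ⟨adj_symm, adj_symm⟩

theorem adj_add_unitVec (x : Fin d → ℤ) (i : Fin d) : Adj x (x + unitVec i) := by
  unfold Adj l1dist
  rw [sum_eq_single i]
  · simp [unitVec]
  · intro j _ hj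
    simp [unitVec, Pi.single_eq_of_ne hj]
  · simp

theorem adj_iff {x y : Fin d → ℤ} :
    Adj x y ↔ ∃ i, y = x + unitVec i ∨ x = y + unitVec i := by
  constructor
  · intro h
    have hne : ∃ i, (x i - y i).natAbs ≠ 0 := by
      by_contra! hcon
      have : l1dist x y = 0 := sum_eq_zero fun i _ => hcon i
      unfold Adj at h
      omega
    obtain ⟨i, hi⟩ := hne
    have hs : (x i - y i).natAbs + ∑ j ∈ univ.erase i, (x j - y j).natAbs = 1 :=
      (add_sum_erase univ (fun j => (x j - y j).natAbs) (mem_univ i)).trans h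
    have h0 : ∑ j ∈ univ.erase i, (x j - y j).natAbs = 0 := by omega
    have hother : ∀ j, j ≠ i → x j = y j := by
      intro j hj
      have := (sum_eq_zero_iff.1 h0) j (mem_erase.2 ⟨hj, mem_univ j⟩)
      omega
    refine ⟨i, ?_⟩
    rcases (show y i = x i + 1 ∨ x i = y i + 1 by omega) with h1 | h1
    · left
      ext j
      by_cases hj : j = i
      · subst hj; simp [unitVec, h1]
      · simp [unitVec, Pi.single_eq_of_ne hj, hother j hj]
    · right
      ext j
      by_cases hj : j = i
      · subst hj; simp [unitVec, h1]
      · simp [unitVec, Pi.single_eq_of_ne hj, hother j hj]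
  · rintro ⟨i, rfl | rfl⟩
    · exact adj_add_unitVec x i
    · exact adj_symm (adj_add_unitVec y i)

theorem ite_adj_eq_sum (x y : Fin d → ℤ) (g : ℝ) :
    (if Adj x y then g else 0)
      = ∑ i, ((if y = x + unitVec i then g else 0) + if x = y + unitVec i then g else 0) := by
  by_cases h : Adj x y
  · rw [if_pos h]
    obtain ⟨i, rfl | rfl⟩ := adj_iff.1 h
    · rw [sum_eq_single i]
      · rw [if_pos rfl, if_neg (ne_add_unitVec_add_unitVec x i i), add_zero]
      · intro j _ hj
        rw [if_neg (fun hc => hj (add_unitVec_inj.1 hc).symm),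
          if_neg (ne_add_unitVec_add_unitVec x i j), add_zero]
      · simp
    · rw [sum_eq_single i]
      · rw [if_pos rfl, if_neg (ne_add_unitVec_add_unitVec y i i), zero_add]
      · intro j _ hj
        rw [if_neg (ne_add_unitVec_add_unitVec y i j),
          if_neg (fun hc => hj (add_unitVec_inj.1 hc).symm), add_zero]
      · simp
  · rw [if_neg h, sum_eq_zero]
    intro i _
    rw [if_neg, if_neg, add_zero]
    · exact fun hc => h (adj_iff.2 ⟨i, Or.inr hc⟩)
    · exact fun hc => h (adj_iff.2 ⟨i, Or.inl hc⟩)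

theorem extend_apply {Λ : Finset (Fin d → ℤ)} (φ : Λ → ℤ) (x : Λ) : extend φ x = φ x := by
  simp [extend]

theorem extend_of_notMem {Λ : Finset (Fin d → ℤ)} (φ : Λ → ℤ) {x : Fin d → ℤ} (hx : x ∉ Λ) :
    extend φ x = 0 := by
  simp [extend, hx]

theorem add_unitVec_mem {Λ B : Finset (Fin d → ℤ)} (hB : Λ ∪ boundary Λ ⊆ B) {x : Fin d → ℤ}
    (hx : x ∈ Λ) (i : Fin d) : x + unitVec i ∈ B := by
  apply hB
  by_cases h : x + unitVec i ∈ Λ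
  · exact mem_union_left _ h
  · exact mem_union_right _ ((mem_boundary _ _).2 ⟨h, x, hx, adj_add_unitVec x i⟩)

theorem sub_unitVec_mem {Λ B : Finset (Fin d → ℤ)} (hB : Λ ∪ boundary Λ ⊆ B) {x : Fin d → ℤ}
    (hx : x ∈ Λ) (i : Fin d) : x - unitVec i ∈ B := by
  apply hB
  by_cases h : x - unitVec i ∈ Λ
  · exact mem_union_left _ h
  · refine mem_union_right _ ((mem_boundary _ _).2 ⟨h, x, hx, adj_symm ?_⟩)
    simpa using adj_add_unitVec (x - unitVec i) i

/-- Every unordered edge is recorded once as a site and a direction, and edges with both ends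
outside `Λ` contribute nothing. The freedom in `B` lets Hamiltonians on different domains be
compared edge by edge. -/
theorem hamiltonian_eq_sum {Λ B : Finset (Fin d → ℤ)} (hB : Λ ∪ boundary Λ ⊆ B) (φ : Λ → ℤ) :
    hamiltonian Λ 0 φ
      = ∑ y ∈ B, ∑ i, |(extend φ (y + unitVec i) : ℝ) - (extend φ y : ℝ)| := by
  set ψ := extend φ with hψ
  set F : (Fin d → ℤ) → (Fin d → ℤ) → ℝ :=
    fun x y => if Adj x y then |(ψ x : ℝ) - (ψ y : ℝ)| else 0 with hF
  have hFsymm : ∀ x y, F x y = F y x := by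
    intro x y
    simp only [hF, adj_comm (x := x) (y := y), abs_sub_comm]
  have hΛB : Λ ⊆ B := subset_union_left.trans hB
  have h1 : hamiltonian Λ 0 φ
      = (1 / 2 : ℝ) * (∑ x ∈ Λ, ∑ y ∈ Λ, F x y) + ∑ x ∈ Λ, ∑ y ∈ boundary Λ, F x y := by
    rw [← sum_coe_sort Λ, ← sum_coe_sort Λ]
    unfold hamiltonian
    congr 1
    · congr 1
      refine sum_congr rfl fun x _ => ?_
      rw [← sum_coe_sort Λ]
      refine sum_congr rfl fun y _ => ?_
      simp only [hF, hψ, extend_apply]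
    · refine sum_congr rfl fun x _ => sum_congr rfl fun y hy => ?_
      simp only [hF, hψ, extend_apply]
      rw [extend_of_notMem φ ((mem_boundary _ _).1 hy).1]
  have h2 : ∀ x ∈ Λ, ∑ y ∈ boundary Λ, F x y = ∑ y ∈ B \ Λ, F x y := by
    intro x hx
    apply sum_subset
    · intro y hy
      exact mem_sdiff.2 ⟨hB (mem_union_right _ hy), ((mem_boundary _ _).1 hy).1⟩
    · intro y hy hy'
      have : ¬ Adj x y := fun h => hy' ((mem_boundary _ _).2 ⟨(mem_sdiff.1 hy).2, x, hx, h⟩)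
      simp only [hF, if_neg this]
  have h3 : ∑ x ∈ B, ∑ y ∈ B, F x y
      = (∑ x ∈ Λ, ∑ y ∈ Λ, F x y) + 2 * ∑ x ∈ Λ, ∑ y ∈ B \ Λ, F x y := by
    have e1 : ∀ x, ∑ y ∈ B, F x y = ∑ y ∈ B \ Λ, F x y + ∑ y ∈ Λ, F x y := fun x =>
      (sum_sdiff hΛB).symm
    have e2 : ∑ x ∈ B \ Λ, ∑ y ∈ B \ Λ, F x y = 0 := by
      refine sum_eq_zero fun x hx => sum_eq_zero fun y hy => ?_
      simp only [hF, hψ, extend_of_notMem φ (mem_sdiff.1 hx).2,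
        extend_of_notMem φ (mem_sdiff.1 hy).2]
      simp
    have e3 : ∑ x ∈ B \ Λ, ∑ y ∈ Λ, F x y = ∑ x ∈ Λ, ∑ y ∈ B \ Λ, F x y := by
      rw [sum_comm]
      exact sum_congr rfl fun x _ => sum_congr rfl fun y _ => hFsymm y x
    rw [← sum_sdiff hΛB (f := fun x => ∑ y ∈ B, F x y)]
    simp only [e1, sum_add_distrib]
    rw [e2, e3]
    ring
  have h4 : ∑ x ∈ B, ∑ y ∈ B, F x y
      = 2 * ∑ y ∈ B, ∑ i, |(ψ (y + unitVec i) : ℝ) - (ψ y : ℝ)| := by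
    -- An edge that leaves `B` has both ends outside `Λ`, so its gradient is zero and restricting
    -- the far end to `B` loses nothing.
    have key : ∀ x ∈ B, ∀ i : Fin d,
        (if x + unitVec i ∈ B then |(ψ x : ℝ) - (ψ (x + unitVec i) : ℝ)| else 0)
          = |(ψ (x + unitVec i) : ℝ) - (ψ x : ℝ)| := by
      intro x _ i
      split_ifs with h
      · exact abs_sub_comm _ _
      · have hx : x ∉ Λ := fun hx => h (add_unitVec_mem hB hx i)
        have hx' : x + unitVec i ∉ Λ := fun hx' => h (hΛB hx')
        simp [hψ, extend_of_notMem φ hx, extend_of_notMem φ hx']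
    have e1 : ∑ x ∈ B, ∑ y ∈ B, ∑ i,
        (if y = x + unitVec i then |(ψ x : ℝ) - (ψ y : ℝ)| else 0)
          = ∑ y ∈ B, ∑ i, |(ψ (y + unitVec i) : ℝ) - (ψ y : ℝ)| := by
      refine sum_congr rfl fun x hx => ?_
      rw [sum_comm]
      refine sum_congr rfl fun i _ => ?_
      rw [sum_ite_eq' B (x + unitVec i) (fun y => |(ψ x : ℝ) - (ψ y : ℝ)|), key x hx i]
    have e2 : ∑ x ∈ B, ∑ y ∈ B, ∑ i,
        (if x = y + unitVec i then |(ψ x : ℝ) - (ψ y : ℝ)| else 0)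
          = ∑ y ∈ B, ∑ i, |(ψ (y + unitVec i) : ℝ) - (ψ y : ℝ)| := by
      rw [sum_comm, ← e1]
      simp only [abs_sub_comm]
    simp only [hF, ite_adj_eq_sum, sum_add_distrib]
    rw [e1, e2]
    ring
  rw [h1, sum_congr rfl h2]
  linarith [h3, h4]

theorem hamiltonian_shift (Λ : Finset (Fin d → ℤ)) (n : ℤ) (φ : Λ → ℤ) :
    hamiltonian Λ n φ = hamiltonian Λ 0 (fun x => φ x - n) := by
  simp [hamiltonian]

theorem hamiltonian_nonneg (Λ : Finset (Fin d → ℤ)) (n : ℤ) (φ : Λ → ℤ) :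
    0 ≤ hamiltonian Λ n φ := by
  unfold hamiltonian
  refine add_nonneg (mul_nonneg (by norm_num) ?_) ?_ <;>
  · refine sum_nonneg fun x _ => sum_nonneg fun y _ => ?_
    split_ifs <;> positivity

theorem hamiltonian_neg (Λ : Finset (Fin d → ℤ)) (φ : Λ → ℤ) :
    hamiltonian Λ 0 (-φ) = hamiltonian Λ 0 φ := by
  rw [hamiltonian_eq_sum subset_rfl, hamiltonian_eq_sum subset_rfl]
  have : ∀ y, extend (-φ) y = - extend φ y := by
    intro y
    by_cases h : y ∈ Λ <;> simp [extend, h]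
  refine sum_congr rfl fun y _ => sum_congr rfl fun i _ => ?_
  rw [this, this, ← abs_neg]
  push_cast
  ring_nf

theorem hamiltonian_zero (Λ : Finset (Fin d → ℤ)) : hamiltonian Λ 0 (0 : Λ → ℤ) = 0 := by
  simp [hamiltonian]

/-- The number of pairs of neighbours made of a site of `Λ` and a site of its boundary. -/
noncomputable def boundaryPairs (Λ : Finset (Fin d → ℤ)) : ℝ :=
  ∑ x : Λ, ∑ y ∈ boundary Λ, if Adj x.1 y then (1 : ℝ) else 0

theorem hamiltonian_le_add (Λ : Finset (Fin d → ℤ)) (m n : ℤ) (φ : Λ → ℤ) :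
    hamiltonian Λ m φ ≤ hamiltonian Λ n φ + |(m : ℝ) - n| * boundaryPairs Λ := by
  unfold hamiltonian boundaryPairs
  rw [add_assoc]
  refine add_le_add le_rfl ?_
  rw [mul_sum, ← sum_add_distrib]
  refine sum_le_sum fun x _ => ?_
  rw [mul_sum, ← sum_add_distrib]
  refine sum_le_sum fun y _ => ?_
  split_ifs
  · rw [mul_one, abs_sub_comm (m : ℝ)]
    exact abs_sub_le _ _ _
  · simp

/-! ### Convergence of the series and elementary bounds on partition functions. -/

/-- A finite set of functions lies in the product of its coordinate projections, over which the sum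
factorises. -/
theorem summable_prod_of_nonneg {ι : Type*} [Fintype ι] {g : ℤ → ℝ} (hg : 0 ≤ g)
    (hs : Summable g) :
    Summable (fun χ : ι → ℤ => ∏ x, g (χ x)) ∧
      ∑' χ : ι → ℤ, ∏ x, g (χ x) ≤ (∑' k, g k) ^ Fintype.card ι := by
  classical
  have hb : ∀ u : Finset (ι → ℤ), ∑ χ ∈ u, ∏ x, g (χ x) ≤ (∑' k, g k) ^ Fintype.card ι := by
    intro u
    calc ∑ χ ∈ u, ∏ x, g (χ x)
        ≤ ∑ χ ∈ Fintype.piFinset (fun x => u.image (fun χ => χ x)), ∏ x, g (χ x) := by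
          apply sum_le_sum_of_subset_of_nonneg
          · intro χ hχ
            exact Fintype.mem_piFinset.2 fun x => mem_image_of_mem _ hχ
          · exact fun _ _ _ => prod_nonneg fun _ _ => hg _
      _ = ∏ x, ∑ k ∈ u.image (fun χ => χ x), g k := by rw [prod_univ_sum]
      _ ≤ ∏ _x : ι, ∑' k, g k := by
          refine prod_le_prod (fun _ _ => sum_nonneg fun _ _ => hg _) fun x _ => ?_
          exact hs.sum_le_tsum _ fun _ _ => hg _
      _ = _ := by simp
  exact ⟨summable_of_sum_le (fun χ => prod_nonneg fun _ _ => hg _) hb,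
    Real.tsum_le_of_sum_le (fun χ => prod_nonneg fun _ _ => hg _) hb⟩

theorem summable_exp_neg_abs {β : ℝ} (hβ : 0 < β) :
    Summable fun k : ℤ => Real.exp (-β * |(k : ℝ)|) := by
  have h : Summable fun n : ℕ => Real.exp (-β * (n : ℝ)) := by
    simpa [mul_comm] using Real.summable_exp_nat_mul_iff.2 (neg_lt_zero.2 hβ)
  apply Summable.of_nat_of_neg <;> simpa using h

/-- The increments of a configuration in direction `i`. -/
def increments {Λ : Finset (Fin d → ℤ)} (i : Fin d) (φ : Λ → ℤ) : Λ → ℤ :=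
  fun x => extend φ x - extend φ (x - unitVec i)

theorem extend_injective {Λ : Finset (Fin d → ℤ)} :
    Function.Injective (extend : (Λ → ℤ) → (Fin d → ℤ) → ℤ) := by
  intro φ φ' h
  ext x
  rw [← extend_apply φ, ← extend_apply φ', h]

/-- If two configurations with equal increments differ at a site, they differ at every earlier site
on the line in direction `i`. They would then differ on an infinite half-line inside the finite set
`Λ`. -/
theorem increments_injective {Λ : Finset (Fin d → ℤ)} (i : Fin d) :
    Function.Injective (increments i : (Λ → ℤ) → Λ → ℤ) := by
  intro φ φ' h
  apply extend_injective
  ext x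
  by_contra hx
  have hmem : ∀ y, extend φ y ≠ extend φ' y → y ∈ Λ := by
    intro y hy
    by_contra hy'
    exact hy (by rw [extend_of_notMem φ hy', extend_of_notMem φ' hy'])
  have hall : ∀ k : ℕ, extend φ (x - k • unitVec i) ≠ extend φ' (x - k • unitVec i) := by
    intro k
    induction k with
    | zero => simpa using hx
    | succ k ih =>
      have := congrFun h ⟨_, hmem _ ih⟩
      simp only [increments] at this
      rw [add_smul, one_smul, ← sub_sub]
      intro hc
      apply ih
      linarith
  have hinj : Function.Injective fun k : ℕ => (⟨_, hmem _ (hall k)⟩ : Λ) := by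
    intro k l hkl
    have := congrFun (congrArg Subtype.val hkl) i
    simpa using this
  exact not_injective_infinite_finite _ hinj

theorem sum_abs_increments_le {Λ : Finset (Fin d → ℤ)} (i : Fin d) (φ : Λ → ℤ) :
    ∑ x, |(increments i φ x : ℝ)| ≤ hamiltonian Λ 0 φ := by
  classical
  rw [hamiltonian_eq_sum subset_rfl]
  calc ∑ x, |(increments i φ x : ℝ)|
      = ∑ x ∈ Λ, |(extend φ x : ℝ) - (extend φ (x - unitVec i) : ℝ)| := by
        rw [← sum_coe_sort Λ]
        simp [increments]
    _ = ∑ y ∈ Λ.image (fun x => x - unitVec i),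
          |(extend φ (y + unitVec i) : ℝ) - (extend φ y : ℝ)| := by
        rw [sum_image (fun x _ y _ h => sub_left_injective h)]
        simp
    _ ≤ ∑ y ∈ Λ ∪ boundary Λ, |(extend φ (y + unitVec i) : ℝ) - (extend φ y : ℝ)| := by
        apply sum_le_sum_of_subset_of_nonneg
        · intro y hy
          obtain ⟨x, hx, rfl⟩ := mem_image.1 hy
          exact sub_unitVec_mem subset_rfl hx i
        · exact fun _ _ _ => abs_nonneg _
    _ ≤ _ := sum_le_sum fun y _ => single_le_sum
        (f := fun i => |(extend φ (y + unitVec i) : ℝ) - (extend φ y : ℝ)|)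
        (fun _ _ => abs_nonneg _) (mem_univ i)

/-- Keeping only the gradients in one direction leaves a product weight in the increments, which is
summable. This single direction is enough for convergence and for a bound exponential in the volume.
-/
theorem exp_hamiltonian_le {Λ : Finset (Fin d → ℤ)} {β : ℝ} (hβ : 0 < β) (i : Fin d)
    (φ : Λ → ℤ) :
    Real.exp (-β * hamiltonian Λ 0 φ) ≤ ∏ x, Real.exp (-β * |(increments i φ x : ℝ)|) := by
  rw [← Real.exp_sum, ← mul_sum]
  apply Real.exp_le_exp.2
  have := mul_le_mul_of_nonneg_left (sum_abs_increments_le i φ) hβ.le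
  linarith

theorem summable_exp_hamiltonian_zero (Λ : Finset (Fin d → ℤ)) {β : ℝ} (hβ : 0 < β)
    (hd : 0 < d) : Summable fun φ : Λ → ℤ => Real.exp (-β * hamiltonian Λ 0 φ) := by
  have h := (summable_prod_of_nonneg (ι := Λ) (fun k => (Real.exp_pos _).le)
    (summable_exp_neg_abs hβ)).1
  exact Summable.of_nonneg_of_le (fun _ => (Real.exp_pos _).le)
    (exp_hamiltonian_le hβ ⟨0, hd⟩) (h.comp_injective (increments_injective ⟨0, hd⟩))

theorem summable_exp_hamiltonian (Λ : Finset (Fin d → ℤ)) {β : ℝ} (hβ : 0 < β)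
    (hd : 0 < d) (n : ℤ) : Summable fun φ : Λ → ℤ => Real.exp (-β * hamiltonian Λ n φ) := by
  have h := (Equiv.subRight (fun _ : Λ => n)).summable_iff.2
    (summable_exp_hamiltonian_zero Λ hβ hd)
  refine h.congr fun φ => ?_
  rw [hamiltonian_shift]
  rfl

theorem summable_mul_exp_hamiltonian (Λ : Finset (Fin d → ℤ)) {β : ℝ} (hβ : 0 < β)
    (hd : 0 < d) (n : ℤ) {F : (Λ → ℤ) → ℝ} {M : ℝ} (hF : ∀ φ, |F φ| ≤ M) :
    Summable fun φ : Λ → ℤ => F φ * Real.exp (-β * hamiltonian Λ n φ) := by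
  refine Summable.of_norm_bounded ((summable_exp_hamiltonian Λ hβ hd n).mul_left M) fun φ => ?_
  rw [Real.norm_eq_abs, abs_mul, abs_of_pos (Real.exp_pos _)]
  exact mul_le_mul_of_nonneg_right (hF φ) (Real.exp_pos _).le

theorem partitionSOS_shift (Λ : Finset (Fin d → ℤ)) (β : ℝ) (n : ℤ) :
    partitionSOS Λ β n = partitionSOS Λ β 0 := by
  unfold partitionSOS
  rw [← (Equiv.subRight (fun _ : Λ => n)).tsum_eq fun φ => Real.exp (-β * hamiltonian Λ 0 φ)]
  refine tsum_congr fun φ => ?_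
  rw [hamiltonian_shift]
  rfl

theorem one_le_partitionSOS (Λ : Finset (Fin d → ℤ)) {β : ℝ} (hβ : 0 < β) (hd : 0 < d) :
    1 ≤ partitionSOS Λ β 0 := by
  have := (summable_exp_hamiltonian Λ hβ hd 0).le_tsum 0 fun _ _ => (Real.exp_pos _).le
  simpa [hamiltonian_zero, partitionSOS] using this

theorem partitionSOS_pos (Λ : Finset (Fin d → ℤ)) {β : ℝ} (hβ : 0 < β) (hd : 0 < d) (n : ℤ) :
    0 < partitionSOS Λ β n := by
  rw [partitionSOS_shift]
  exact zero_lt_one.trans_le (one_le_partitionSOS Λ hβ hd)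

theorem partitionSOS_le (Λ : Finset (Fin d → ℤ)) {β : ℝ} (hβ : 0 < β) (hd : 0 < d) :
    partitionSOS Λ β 0 ≤ (∑' k : ℤ, Real.exp (-β * |(k : ℝ)|)) ^ Λ.card := by
  have h := summable_prod_of_nonneg (ι := Λ) (fun k => (Real.exp_pos _).le)
    (summable_exp_neg_abs hβ)
  have hi := increments_injective (Λ := Λ) ⟨0, hd⟩
  calc partitionSOS Λ β 0
      ≤ ∑' φ : Λ → ℤ, ∏ x, Real.exp (-β * |(increments ⟨0, hd⟩ φ x : ℝ)|) :=
        (summable_exp_hamiltonian Λ hβ hd 0).tsum_le_tsum (exp_hamiltonian_le hβ ⟨0, hd⟩)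
          (h.1.comp_injective hi)
    _ ≤ ∑' χ : Λ → ℤ, ∏ x, Real.exp (-β * |(χ x : ℝ)|) :=
        tsum_comp_le_tsum_of_inj h.1 (fun _ => prod_nonneg fun _ _ => (Real.exp_pos _).le) hi
    _ ≤ _ := by simpa using h.2

theorem contacts_le {Λ : Finset (Fin d → ℤ)} (φ : Λ → ℤ) : contacts φ ≤ Λ.card :=
  (card_filter_le _ _).trans (by simp)

theorem mul_contacts_le {Λ : Finset (Fin d → ℤ)} (h : ℝ) (φ : Λ → ℤ) :
    h * (contacts φ : ℝ) ≤ |h| * Λ.card :=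
  mul_le_mul (le_abs_self h) (by exact_mod_cast contacts_le φ) (by positivity) (abs_nonneg h)

theorem partition_eq (Λ : Finset (Fin d → ℤ)) (β : ℝ) (n : ℤ) (h : ℝ) :
    partition Λ β n h
      = ∑' φ : Λ → ℤ, Real.exp (h * contacts φ) * Real.exp (-β * hamiltonian Λ n φ) := by
  unfold partition
  exact tsum_congr fun φ => by rw [add_comm, Real.exp_add]

theorem abs_exp_contacts_le {Λ : Finset (Fin d → ℤ)} (h : ℝ) (φ : Λ → ℤ) :
    |Real.exp (h * contacts φ)| ≤ Real.exp (|h| * Λ.card) := by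
  rw [abs_of_pos (Real.exp_pos _)]
  exact Real.exp_le_exp.2 (mul_contacts_le h φ)

theorem summable_partition (Λ : Finset (Fin d → ℤ)) {β : ℝ} (hβ : 0 < β) (hd : 0 < d)
    (n : ℤ) (h : ℝ) : Summable fun φ : Λ → ℤ =>
      Real.exp (h * contacts φ) * Real.exp (-β * hamiltonian Λ n φ) :=
  summable_mul_exp_hamiltonian Λ hβ hd n (abs_exp_contacts_le h)

theorem exp_le_partition (Λ : Finset (Fin d → ℤ)) {β : ℝ} (hβ : 0 < β) (hd : 0 < d) (h : ℝ) :
    Real.exp (h * Λ.card) ≤ partition Λ β 0 h := by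
  rw [partition_eq]
  have := (summable_partition Λ hβ hd 0 h).le_tsum 0 fun _ _ => by positivity
  simpa [hamiltonian_zero, contacts] using this

theorem partition_pos (Λ : Finset (Fin d → ℤ)) {β : ℝ} (hβ : 0 < β) (hd : 0 < d) (n : ℤ)
    (h : ℝ) : 0 < partition Λ β n h := by
  rw [partition_eq]
  exact (summable_partition Λ hβ hd n h).tsum_pos (fun _ => by positivity) 0 (by positivity)

theorem partition_le (Λ : Finset (Fin d → ℤ)) {β : ℝ} (hβ : 0 < β) (hd : 0 < d) (n : ℤ)
    (h : ℝ) : partition Λ β n h ≤ Real.exp (|h| * Λ.card) * partitionSOS Λ β n := by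
  rw [partition_eq, partitionSOS, ← tsum_mul_left]
  refine (summable_partition Λ hβ hd n h).tsum_le_tsum (fun φ => ?_)
    ((summable_exp_hamiltonian Λ hβ hd n).mul_left _)
  exact mul_le_mul_of_nonneg_right ((le_abs_self _).trans (abs_exp_contacts_le h φ))
    (Real.exp_pos _).le

theorem partition_zero (Λ : Finset (Fin d → ℤ)) (β : ℝ) (n : ℤ) :
    partition Λ β n 0 = partitionSOS Λ β n := by
  simp [partition, partitionSOS]

theorem partition_mono (Λ : Finset (Fin d → ℤ)) {β : ℝ} (hβ : 0 < β) (hd : 0 < d) (n : ℤ) :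
    Monotone (partition Λ β n) := by
  intro h h' hh
  rw [partition_eq, partition_eq]
  refine (summable_partition Λ hβ hd n h).tsum_le_tsum (fun φ => ?_)
    (summable_partition Λ hβ hd n h')
  gcongr

theorem partition_le_partition (Λ : Finset (Fin d → ℤ)) {β : ℝ} (hβ : 0 < β) (hd : 0 < d)
    (m n : ℤ) (h : ℝ) :
    partition Λ β m h
      ≤ Real.exp (β * (|(m : ℝ) - n| * boundaryPairs Λ)) * partition Λ β n h := by
  rw [partition_eq, partition_eq, ← tsum_mul_left]
  refine (summable_partition Λ hβ hd m h).tsum_le_tsum (fun φ => ?_)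
    ((summable_partition Λ hβ hd n h).mul_left _)
  rw [mul_left_comm, ← Real.exp_add (β * _)]
  refine mul_le_mul_of_nonneg_left (Real.exp_le_exp.2 ?_) (Real.exp_pos _).le
  have := mul_le_mul_of_nonneg_left (hamiltonian_le_add Λ n m φ) hβ.le
  rw [abs_sub_comm] at this
  linarith

theorem log_partition_le_log_partition (Λ : Finset (Fin d → ℤ)) {β : ℝ} (hβ : 0 < β)
    (hd : 0 < d) (m n : ℤ) (h : ℝ) :
    Real.log (partition Λ β m h)
      ≤ β * (|(m : ℝ) - n| * boundaryPairs Λ) + Real.log (partition Λ β n h) := by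
  have := Real.log_le_log (partition_pos Λ hβ hd m h) (partition_le_partition Λ hβ hd m n h)
  rwa [Real.log_mul (Real.exp_pos _).ne' (partition_pos Λ hβ hd n h).ne', Real.log_exp] at this

/-! ### Gluing, translation and superadditivity. -/

theorem contacts_eq_card_filter {Λ : Finset (Fin d → ℤ)} (φ : Λ → ℤ) :
    contacts φ = (Λ.filter fun x => extend φ x = 0).card := by
  unfold contacts
  rw [← card_map (Function.Embedding.subtype (· ∈ Λ))]
  congr 1
  ext x
  simp only [mem_map, mem_filter, mem_univ, true_and, Function.Embedding.subtype_apply]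
  constructor
  · rintro ⟨y, hy, rfl⟩
    exact ⟨y.2, by rw [extend_apply, hy]⟩
  · rintro ⟨hx, h0⟩
    exact ⟨⟨x, hx⟩, by rw [← extend_apply φ ⟨x, hx⟩, h0], rfl⟩

/-- The configuration on `Λ ∪ Λ'` made of configurations on disjoint sets `Λ` and `Λ'`. -/
def glue {Λ Λ' : Finset (Fin d → ℤ)} (p : (Λ → ℤ) × (Λ' → ℤ)) : (Λ ∪ Λ' : Finset _) → ℤ :=
  fun x => extend p.1 x + extend p.2 x

section Glue

variable {Λ Λ' : Finset (Fin d → ℤ)}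

theorem extend_glue (p : (Λ → ℤ) × (Λ' → ℤ)) (x : Fin d → ℤ) :
    extend (glue p) x = extend p.1 x + extend p.2 x := by
  by_cases h : x ∈ Λ ∪ Λ'
  · exact extend_apply (glue p) ⟨x, h⟩
  · rw [extend_of_notMem _ h]
    rw [mem_union, not_or] at h
    rw [extend_of_notMem _ h.1, extend_of_notMem _ h.2, add_zero]

theorem glue_injective (hdis : Disjoint Λ Λ') :
    Function.Injective (glue : (Λ → ℤ) × (Λ' → ℤ) → _) := by
  intro p p' h
  ext x
  · have := congrFun h ⟨x, mem_union_left _ x.2⟩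
    have hx := disjoint_left.1 hdis x.2
    simpa [glue, extend_of_notMem _ hx, extend_apply] using this
  · have := congrFun h ⟨x, mem_union_right _ x.2⟩
    have hx := disjoint_right.1 hdis x.2
    simpa [glue, extend_of_notMem _ hx, extend_apply] using this

theorem contacts_glue (hdis : Disjoint Λ Λ') (p : (Λ → ℤ) × (Λ' → ℤ)) :
    contacts (glue p) = contacts p.1 + contacts p.2 := by
  simp only [contacts_eq_card_filter, extend_glue]
  rw [filter_union, card_union_of_disjoint (disjoint_filter_filter hdis)]
  congr 2
  · refine filter_congr fun x hx => ?_
    rw [extend_of_notMem p.2 (disjoint_left.1 hdis hx), add_zero]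
  · refine filter_congr fun x hx => ?_
    rw [extend_of_notMem p.1 (disjoint_right.1 hdis hx), zero_add]

/-- Extended by zero, the glued configuration is the sum of its two pieces, so this is the triangle
inequality on each edge. -/
theorem hamiltonian_glue_le (p : (Λ → ℤ) × (Λ' → ℤ)) :
    hamiltonian (Λ ∪ Λ') 0 (glue p) ≤ hamiltonian Λ 0 p.1 + hamiltonian Λ' 0 p.2 := by
  set B := (Λ ∪ boundary Λ) ∪ (Λ' ∪ boundary Λ') ∪ ((Λ ∪ Λ') ∪ boundary (Λ ∪ Λ'))
  rw [hamiltonian_eq_sum (B := B) subset_union_right,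
    hamiltonian_eq_sum (B := B) (subset_union_left.trans subset_union_left),
    hamiltonian_eq_sum (B := B) (subset_union_right.trans subset_union_left),
    ← sum_add_distrib]
  refine sum_le_sum fun y _ => ?_
  rw [← sum_add_distrib]
  refine sum_le_sum fun i _ => ?_
  rw [extend_glue, extend_glue]
  push_cast
  rw [add_sub_add_comm]
  exact abs_add_le _ _

theorem partition_mul_le (hdis : Disjoint Λ Λ') {β : ℝ} (hβ : 0 < β) (hd : 0 < d) (h : ℝ) :
    partition Λ β 0 h * partition Λ' β 0 h ≤ partition (Λ ∪ Λ') β 0 h := by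
  have hs := summable_partition Λ hβ hd 0 h
  have hs' := summable_partition Λ' hβ hd 0 h
  have hsu := summable_partition (Λ ∪ Λ') hβ hd 0 h
  have hm := hs.mul_of_nonneg hs' (fun _ => by positivity) (fun _ => by positivity)
  have hi := glue_injective hdis
  rw [partition_eq, partition_eq, partition_eq, hs.tsum_mul_tsum hs' hm]
  refine le_trans (hm.tsum_le_tsum (fun p => ?_) (hsu.comp_injective hi))
    (tsum_comp_le_tsum_of_inj hsu (fun _ => by positivity) hi)
  simp only [Function.comp_apply, contacts_glue hdis]
  rw [mul_mul_mul_comm, ← Real.exp_add, ← Real.exp_add, ← Real.exp_add, ← Real.exp_add]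
  apply Real.exp_le_exp.2
  push_cast
  have := mul_le_mul_of_nonneg_left (hamiltonian_glue_le p) hβ.le
  linarith

end Glue

/-- The logarithm of the partition function, relative to the contribution of the flat
configuration. -/
noncomputable def excess (Λ : Finset (Fin d → ℤ)) (β h : ℝ) : ℝ :=
  Real.log (partition Λ β 0 h) - h * Λ.card

theorem excess_nonneg (Λ : Finset (Fin d → ℤ)) {β : ℝ} (hβ : 0 < β) (hd : 0 < d) (h : ℝ) :
    0 ≤ excess Λ β h := by
  have := Real.log_le_log (Real.exp_pos _) (exp_le_partition Λ hβ hd h)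
  rw [Real.log_exp] at this
  unfold excess
  linarith

theorem excess_add_le {Λ Λ' : Finset (Fin d → ℤ)} (hdis : Disjoint Λ Λ') {β : ℝ} (hβ : 0 < β)
    (hd : 0 < d) (h : ℝ) : excess Λ β h + excess Λ' β h ≤ excess (Λ ∪ Λ') β h := by
  have := Real.log_le_log (mul_pos (partition_pos Λ hβ hd 0 h) (partition_pos Λ' hβ hd 0 h))
    (partition_mul_le hdis hβ hd h)
  rw [Real.log_mul (partition_pos Λ hβ hd 0 h).ne' (partition_pos Λ' hβ hd 0 h).ne'] at this
  unfold excess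
  rw [card_union_of_disjoint hdis]
  push_cast
  linarith

/-- Subtracting the flat contribution makes the excess non-negative, so superadditivity also yields
monotonicity, even for negative `h`. Sites left over by a tiling can therefore be discarded. -/
theorem excess_mono {Λ Λ' : Finset (Fin d → ℤ)} (hsub : Λ ⊆ Λ') {β : ℝ} (hβ : 0 < β)
    (hd : 0 < d) (h : ℝ) : excess Λ β h ≤ excess Λ' β h := by
  have := excess_add_le (disjoint_sdiff (s := Λ) (t := Λ')) hβ hd h
  rw [union_sdiff_of_subset hsub] at this
  linarith [excess_nonneg (Λ' \ Λ) hβ hd h]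

theorem excess_le (Λ : Finset (Fin d → ℤ)) {β : ℝ} (hβ : 0 < β) (hd : 0 < d) (h : ℝ) :
    excess Λ β h
      ≤ (2 * |h| + Real.log (∑' k : ℤ, Real.exp (-β * |(k : ℝ)|))) * Λ.card := by
  have h1 := Real.log_le_log (partition_pos Λ hβ hd 0 h) (partition_le Λ hβ hd 0 h)
  have h2 := Real.log_le_log (partitionSOS_pos Λ hβ hd 0) (partitionSOS_le Λ hβ hd)
  rw [Real.log_mul (Real.exp_pos _).ne' (partitionSOS_pos Λ hβ hd 0).ne', Real.log_exp] at h1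
  rw [Real.log_pow] at h2
  have h3 : -h * (Λ.card : ℝ) ≤ |h| * Λ.card :=
    mul_le_mul_of_nonneg_right (neg_le_abs h) (by positivity)
  unfold excess
  linarith

theorem excess_biUnion {ι : Type*} (s : Finset ι) (f : ι → Finset (Fin d → ℤ))
    (hdis : (s : Set ι).PairwiseDisjoint f) {β : ℝ} (hβ : 0 < β) (hd : 0 < d) (h : ℝ) :
    ∑ i ∈ s, excess (f i) β h ≤ excess (s.biUnion f) β h := by
  classical
  induction s using Finset.induction_on with
  | empty => simpa using excess_nonneg ∅ hβ hd h
  | insert i s hi ih =>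
    rw [sum_insert hi, biUnion_insert]
    refine le_trans (add_le_add le_rfl (ih (hdis.subset (by simp)))) (excess_add_le ?_ hβ hd h)
    rw [disjoint_biUnion_right]
    intro j hj
    exact hdis (by simp) (by simp [hj]) (fun hc => hi (hc ▸ hj))

/-- The translate of `Λ` by the vector `v`. -/
def translate (Λ : Finset (Fin d → ℤ)) (v : Fin d → ℤ) : Finset (Fin d → ℤ) :=
  Λ.map (Equiv.addRight v).toEmbedding

section Translate

variable (Λ : Finset (Fin d → ℤ)) (v : Fin d → ℤ)

theorem mem_translate {x : Fin d → ℤ} : x ∈ translate Λ v ↔ x - v ∈ Λ := by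
  simp [translate, sub_eq_add_neg]

theorem add_mem_translate {x : Fin d → ℤ} : x + v ∈ translate Λ v ↔ x ∈ Λ := by
  simp [mem_translate]

theorem card_translate : (translate Λ v).card = Λ.card := card_map _

theorem sum_translate (f : (Fin d → ℤ) → ℝ) :
    ∑ y ∈ translate Λ v, f y = ∑ y ∈ Λ, f (y + v) := sum_map _ _ _

theorem card_filter_translate (p : (Fin d → ℤ) → Prop) [DecidablePred p] :
    ((translate Λ v).filter p).card = (Λ.filter fun y => p (y + v)).card := by
  unfold translate
  rw [filter_map, card_map]
  rfl

theorem l1dist_sub (x y : Fin d → ℤ) : l1dist (x - v) (y - v) = l1dist x y := by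
  simp [l1dist]

theorem boundary_translate : boundary (translate Λ v) = translate (boundary Λ) v := by
  ext y
  rw [mem_boundary, mem_translate, mem_translate, mem_boundary]
  refine and_congr_right fun _ => ⟨?_, ?_⟩
  · rintro ⟨x, hx, hxy⟩
    refine ⟨x - v, (mem_translate Λ v).1 hx, ?_⟩
    rwa [Adj, l1dist_sub]
  · rintro ⟨x, hx, hxy⟩
    refine ⟨x + v, (add_mem_translate Λ v).2 hx, ?_⟩
    rw [Adj] at *
    rw [← hxy, ← l1dist_sub v]
    simp

/-- Configurations on a translate of `Λ` correspond to configurations on `Λ`. -/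
def translateEquiv : (translate Λ v → ℤ) ≃ (Λ → ℤ) :=
  (Equiv.subtypeEquiv (Equiv.addRight v) fun _ => (add_mem_translate Λ v).symm).symm.arrowCongr
    (Equiv.refl ℤ)

theorem extend_translateEquiv (φ : translate Λ v → ℤ) (x : Fin d → ℤ) :
    extend (translateEquiv Λ v φ) x = extend φ (x + v) := by
  by_cases h : x ∈ Λ
  · have h' := (add_mem_translate Λ v).2 h
    rw [extend_apply _ (⟨x, h⟩ : Λ), extend_apply _ (⟨x + v, h'⟩ : translate Λ v)]
    rfl
  · rw [extend_of_notMem _ h, extend_of_notMem _ (fun hc => h ((add_mem_translate Λ v).1 hc))]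

theorem hamiltonian_translateEquiv (φ : translate Λ v → ℤ) :
    hamiltonian Λ 0 (translateEquiv Λ v φ) = hamiltonian (translate Λ v) 0 φ := by
  have hB : translate Λ v ∪ boundary (translate Λ v) = translate (Λ ∪ boundary Λ) v := by
    rw [boundary_translate]
    ext x
    simp [mem_translate]
  rw [hamiltonian_eq_sum subset_rfl, hamiltonian_eq_sum hB.le, sum_translate]
  refine sum_congr rfl fun y _ => sum_congr rfl fun i _ => ?_
  simp only [extend_translateEquiv]
  rw [add_right_comm]

theorem contacts_translateEquiv (φ : translate Λ v → ℤ) :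
    contacts (translateEquiv Λ v φ) = contacts φ := by
  rw [contacts_eq_card_filter, contacts_eq_card_filter, card_filter_translate]
  simp only [extend_translateEquiv]

theorem partition_translate (β h : ℝ) :
    partition (translate Λ v) β 0 h = partition Λ β 0 h := by
  unfold partition
  rw [← (translateEquiv Λ v).tsum_eq]
  refine tsum_congr fun φ => ?_
  rw [hamiltonian_translateEquiv, contacts_translateEquiv]

theorem excess_translate (β h : ℝ) : excess (translate Λ v) β h = excess Λ β h := by
  rw [excess, excess, partition_translate, card_translate]

theorem expectation_translate (β : ℝ) (f : ((Fin d → ℤ) → ℤ) → ℝ) :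
    expectation (translate Λ v) β f = expectation Λ β fun ψ => f fun y => ψ (y - v) := by
  unfold expectation
  rw [← partition_zero, ← partition_zero, partition_translate]
  congr 1
  rw [← (translateEquiv Λ v).tsum_eq]
  refine tsum_congr fun φ => ?_
  rw [hamiltonian_translateEquiv]
  congr 2
  funext y
  rw [extend_translateEquiv, sub_add_cancel]

end Translate

theorem mem_box {N : ℕ} {x : Fin d → ℤ} : x ∈ box d N ↔ ∀ i, 1 ≤ x i ∧ x i ≤ N := by
  simp [box, Pi.le_def, forall_and]

theorem excess_box_ge {β : ℝ} (hβ : 0 < β) (hd : 0 < d) (h : ℝ) (N M : ℕ) :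
    ((N / M : ℕ) : ℝ) ^ d * excess (box d M) β h ≤ excess (box d N) β h := by
  -- `K` indexes the disjoint translates of the smaller box that tile part of the larger one.
  set K : Finset (Fin d → ℤ) := Fintype.piFinset fun _ => Finset.Ico (0 : ℤ) (N / M : ℕ) with hK
  set f : (Fin d → ℤ) → Finset (Fin d → ℤ) := fun k => translate (box d M) ((M : ℤ) • k) with hf
  have hdis : (K : Set (Fin d → ℤ)).PairwiseDisjoint f := by
    intro k _ l _ hkl
    rw [Function.onFun, disjoint_left]
    intro x hx hx'
    apply hkl
    ext i
    have h1 := mem_box.1 ((mem_translate _ _).1 hx) i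
    have h2 := mem_box.1 ((mem_translate _ _).1 hx') i
    simp only [Pi.sub_apply, Pi.smul_apply, smul_eq_mul] at h1 h2
    by_contra hne
    rcases lt_or_gt_of_ne hne with hlt | hlt
    · nlinarith
    · nlinarith
  have hsub : K.biUnion f ⊆ box d N := by
    intro x hx
    obtain ⟨k, hk, hx⟩ := mem_biUnion.1 hx
    rw [mem_box]
    intro i
    have h1 := mem_box.1 ((mem_translate _ _).1 hx) i
    have h2 := mem_Ico.1 (Fintype.mem_piFinset.1 hk i)
    simp only [Pi.sub_apply, Pi.smul_apply, smul_eq_mul] at h1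
    have h3 : (M : ℤ) * (N / M : ℕ) ≤ N := by exact_mod_cast Nat.mul_div_le N M
    constructor
    · nlinarith
    · nlinarith
  have := (excess_biUnion K f hdis hβ hd h).trans (excess_mono hsub hβ hd h)
  have hcard : K.card = (N / M) ^ d := by
    rw [hK, Fintype.card_piFinset]
    simp only [Int.card_Ico, sub_zero, Int.toNat_natCast, prod_const, card_univ, Fintype.card_fin]
  simp only [hf, excess_translate, sum_const, hcard, nsmul_eq_mul] at this
  exact_mod_cast this

end SOS

/-! ### Existence of the free energies. -/

namespace SOS

open Finset Filter Topology

variable {d : ℕ}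

/-- Fekete's argument on cubes: the limit is the supremum of the ratios, since the tiled fraction of
a large cube tends to one. -/
theorem exists_tendsto_div_pow {a : ℕ → ℝ} {C : ℝ}
    (hC : ∀ N, a N ≤ C * (N : ℝ) ^ d)
    (hsup : ∀ N M, ((N / M : ℕ) : ℝ) ^ d * a M ≤ a N) :
    ∃ L, Tendsto (fun N : ℕ => a N / (N : ℝ) ^ d) atTop (𝓝 L) := by
  -- The shift to `M + 1` excludes the empty box, whose ratio is meaningless.
  set S : Set ℝ := Set.range fun M : ℕ => a (M + 1) / ((M + 1 : ℕ) : ℝ) ^ d with hS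
  have hbdd : BddAbove S := by
    refine ⟨C, ?_⟩
    rintro _ ⟨M, rfl⟩
    exact (div_le_iff₀ (by positivity)).2 (hC (M + 1))
  refine ⟨sSup S, tendsto_order.2 ⟨fun b hb => ?_, fun b hb => ?_⟩⟩
  · obtain ⟨_, ⟨M, rfl⟩, hM⟩ := exists_lt_of_lt_csSup (Set.range_nonempty _) hb
    set m : ℕ := M + 1
    have hm : (0 : ℝ) < m := by positivity
    have hfl : Tendsto (fun N : ℕ => ((N / m : ℕ) : ℝ) / N) atTop (𝓝 ((m : ℝ)⁻¹)) := by
      have := (tendsto_nat_floor_mul_div_atTop (R := ℝ) (inv_nonneg.2 hm.le)).comp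
        tendsto_natCast_atTop_atTop
      refine this.congr fun N => ?_
      simp only [Function.comp_apply]
      rw [inv_mul_eq_div, Nat.floor_div_eq_div]
    have hlim : Tendsto (fun N : ℕ => (((N / m : ℕ) : ℝ) / N) ^ d * a m) atTop
        (𝓝 (a m / (m : ℝ) ^ d)) := by
      have := (hfl.pow d).mul_const (a m)
      rwa [inv_pow, inv_mul_eq_div] at this
    filter_upwards [(tendsto_order.1 hlim).1 b hM, eventually_gt_atTop 0] with N hN hN0
    have hN0' : (0 : ℝ) < N := by exact_mod_cast hN0
    refine hN.trans_le ?_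
    rw [div_pow, div_mul_eq_mul_div]
    gcongr
    exact hsup N m
  · filter_upwards [eventually_gt_atTop 0] with N hN
    obtain ⟨M, rfl⟩ := Nat.exists_eq_succ_of_ne_zero hN.ne'
    exact (le_csSup hbdd ⟨M, rfl⟩).trans_lt hb

theorem card_box (N : ℕ) : (box d N).card = N ^ d := by
  simp [box, Pi.card_Icc]

/-- The sites of the box `{1, …, N}^d` at depth at least `R`. -/
noncomputable def bulk (d N R : ℕ) : Finset (Fin d → ℤ) :=
  Finset.Icc (fun _ => 1 + (R : ℤ)) (fun _ => (N : ℤ) - R)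

theorem mem_bulk {N R : ℕ} {x : Fin d → ℤ} :
    x ∈ bulk d N R ↔ ∀ i, 1 + (R : ℤ) ≤ x i ∧ x i ≤ N - R := by
  simp [bulk, Pi.le_def, forall_and]

theorem card_bulk (N R : ℕ) : (bulk d N R).card = (N - 2 * R) ^ d := by
  have : ((N : ℤ) - R + 1 - (1 + (R : ℤ))).toNat = N - 2 * R := by omega
  simp [bulk, Pi.card_Icc, this]

theorem bulk_subset_box (N R : ℕ) : bulk d N R ⊆ box d N := by
  intro x hx
  rw [mem_box]
  intro i
  have := mem_bulk.1 hx i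
  omega

theorem tendsto_card_bulk (R : ℕ) :
    Tendsto (fun N : ℕ => ((bulk d N R).card : ℝ) / (N : ℝ) ^ d) atTop (𝓝 1) := by
  have h1 : Tendsto (fun N : ℕ => (1 - (2 * R : ℝ) / N) ^ d) atTop (𝓝 1) := by
    have : Tendsto (fun N : ℕ => (2 * R : ℝ) / N) atTop (𝓝 0) :=
      tendsto_const_nhds.div_atTop tendsto_natCast_atTop_atTop
    simpa using ((tendsto_const_nhds (x := (1 : ℝ))).sub this).pow d
  refine h1.congr' ?_
  filter_upwards [eventually_gt_atTop (2 * R)] with N hN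
  have hN0 : (N : ℝ) ≠ 0 := by
    have : 0 < N := by omega
    positivity
  rw [card_bulk, Nat.cast_pow, Nat.cast_sub hN.le, ← div_pow, sub_div, div_self hN0]
  push_cast
  rfl

theorem sum_ite_adj_le (x : Fin d → ℤ) (S : Finset (Fin d → ℤ)) :
    ∑ y ∈ S, (if Adj x y then (1 : ℝ) else 0) ≤ 2 * d := by
  simp only [ite_adj_eq_sum]
  rw [sum_comm]
  have : ∀ i : Fin d, ∑ y ∈ S, ((if y = x + unitVec i then (1 : ℝ) else 0)
      + if x = y + unitVec i then 1 else 0) ≤ 2 := by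
    intro i
    have e : ∀ y, (x = y + unitVec i) ↔ (y = x - unitVec i) := fun y =>
      eq_comm.trans eq_sub_iff_add_eq.symm
    simp only [sum_add_distrib, e, sum_ite_eq']
    split_ifs <;> norm_num
  calc _ ≤ ∑ _i : Fin d, (2 : ℝ) := sum_le_sum fun i _ => this i
    _ = 2 * d := by simp [mul_comm]

theorem boundaryPairs_nonneg (Λ : Finset (Fin d → ℤ)) : 0 ≤ boundaryPairs Λ :=
  sum_nonneg fun _ _ => sum_nonneg fun _ _ => by split_ifs <;> norm_num

/-- Sites at depth at least one have no neighbour outside the box, and each remaining site has at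
most `2 * d` neighbours. -/
theorem boundaryPairs_box_le (N : ℕ) :
    boundaryPairs (box d N) ≤ 2 * d * ((N : ℝ) ^ d - (bulk d N 1).card) := by
  unfold boundaryPairs
  rw [sum_coe_sort (box d N)
    (fun x => ∑ y ∈ boundary (box d N), if Adj x y then (1 : ℝ) else 0),
    ← sum_sdiff (bulk_subset_box N 1)]
  have h0 : ∑ x ∈ bulk d N 1, ∑ y ∈ boundary (box d N), (if Adj x y then (1 : ℝ) else 0) = 0 := by
    refine sum_eq_zero fun x hx => sum_eq_zero fun y hy => if_neg fun h => ?_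
    apply ((mem_boundary _ _).1 hy).1
    rw [mem_box]
    intro i
    have h1 := mem_bulk.1 hx i
    have h2 : (x i - y i).natAbs ≤ l1dist x y :=
      single_le_sum (f := fun i => (x i - y i).natAbs) (fun _ _ => Nat.zero_le _) (mem_univ i)
    rw [h] at h2
    push_cast at h1
    omega
  rw [h0, add_zero]
  refine (sum_le_sum fun x _ => sum_ite_adj_le x _).trans ?_
  rw [sum_const, card_sdiff_of_subset (bulk_subset_box N 1), nsmul_eq_mul,
    Nat.cast_sub (card_le_card (bulk_subset_box N 1)), card_box]
  push_cast
  exact (mul_comm _ _).le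

theorem tendsto_boundaryPairs (d : ℕ) :
    Tendsto (fun N : ℕ => boundaryPairs (box d N) / (N : ℝ) ^ d) atTop (𝓝 0) := by
  have h1 : Tendsto (fun N : ℕ => 2 * (d : ℝ) * (1 - ((bulk d N 1).card : ℝ) / (N : ℝ) ^ d))
      atTop (𝓝 0) := by
    simpa using ((tendsto_const_nhds (x := (1 : ℝ))).sub
      (tendsto_card_bulk (d := d) 1)).const_mul (2 * (d : ℝ))
  refine squeeze_zero' (Eventually.of_forall fun N =>
    div_nonneg (boundaryPairs_nonneg _) (by positivity)) ?_ h1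
  filter_upwards [eventually_gt_atTop 0] with N hN
  have hN' : (0 : ℝ) < (N : ℝ) ^ d := by positivity
  rw [div_le_iff₀ hN', mul_assoc, sub_mul, div_mul_cancel₀ _ hN'.ne', one_mul]
  exact boundaryPairs_box_le N

theorem tendsto_log_partition_zero (hd : 0 < d) {β : ℝ} (hβ : 0 < β) (h : ℝ) :
    Tendsto (fun N : ℕ => Real.log (partition (box d N) β 0 h) / (N : ℝ) ^ d) atTop
      (𝓝 (freeEnergy d β h)) := by
  obtain ⟨L, hL⟩ := exists_tendsto_div_pow (a := fun N => excess (box d N) β h) (d := d)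
    (C := 2 * |h| + Real.log (∑' k : ℤ, Real.exp (-β * |(k : ℝ)|)))
    (fun N => by simpa [card_box] using excess_le (box d N) hβ hd h)
    (fun N M => excess_box_ge hβ hd h N M)
  have h1 : Tendsto (fun N : ℕ => Real.log (partition (box d N) β 0 h) / (N : ℝ) ^ d) atTop
      (𝓝 (L + h)) := by
    refine (hL.add_const h).congr' ?_
    filter_upwards [eventually_gt_atTop 0] with N hN
    have hN' : (N : ℝ) ^ d ≠ 0 := by positivity
    unfold excess
    rw [card_box]
    push_cast
    field_simp
    ring
  unfold freeEnergy
  rwa [h1.limUnder_eq]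

theorem tendsto_log_partition (hd : 0 < d) {β : ℝ} (hβ : 0 < β) (n : ℤ) (h : ℝ) :
    Tendsto (fun N : ℕ => Real.log (partition (box d N) β n h) / (N : ℝ) ^ d) atTop
      (𝓝 (freeEnergy d β h)) := by
  have hlim := tendsto_log_partition_zero hd hβ h
  have hb := (tendsto_boundaryPairs d).const_mul (β * |(n : ℝ)|)
  rw [mul_zero] at hb
  refine tendsto_of_tendsto_of_tendsto_of_le_of_le (by simpa using hlim.sub hb)
    (by simpa using hlim.add hb) (fun N => ?_) (fun N => ?_)
  · have := log_partition_le_log_partition (box d N) hβ hd 0 n h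
    rw [Int.cast_zero, zero_sub, abs_neg] at this
    simp only
    rw [← mul_div_assoc, ← sub_div]
    gcongr
    linarith
  · have := log_partition_le_log_partition (box d N) hβ hd n 0 h
    rw [Int.cast_zero, sub_zero] at this
    simp only
    rw [← mul_div_assoc, ← add_div]
    gcongr
    linarith

theorem freeEnergySOS_eq (d : ℕ) (β : ℝ) : freeEnergySOS d β = freeEnergy d β 0 := by
  simp [freeEnergySOS, freeEnergy, partition_zero]

theorem tendsto_log_partitionSOS (hd : 0 < d) {β : ℝ} (hβ : 0 < β) (n : ℤ) :
    Tendsto (fun N : ℕ => Real.log (partitionSOS (box d N) β n) / (N : ℝ) ^ d) atTop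
      (𝓝 (freeEnergySOS d β)) := by
  simpa [freeEnergySOS_eq, partition_zero] using tendsto_log_partition hd hβ n 0

/-! ### Convexity in `h` and mean contacts. -/

/-- The mean number of contacts for the model without interaction. -/
noncomputable def meanContacts (Λ : Finset (Fin d → ℤ)) (β : ℝ) (n : ℤ) : ℝ :=
  (∑' φ : Λ → ℤ, (contacts φ : ℝ) * Real.exp (-β * hamiltonian Λ n φ)) / partitionSOS Λ β n

section Convexity

variable (Λ : Finset (Fin d → ℤ)) {β : ℝ}


theorem summable_contacts (hβ : 0 < β) (hd : 0 < d) (n : ℤ) :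
    Summable fun φ : Λ → ℤ => (contacts φ : ℝ) * Real.exp (-β * hamiltonian Λ n φ) :=
  summable_mul_exp_hamiltonian Λ hβ hd n (M := Λ.card) fun φ => by
    rw [abs_of_nonneg (by positivity)]
    exact_mod_cast contacts_le φ

/-- Jensen's inequality, obtained by summing the tangent-line bound for the exponential at the mean
`m` of `h` times the number of contacts. -/
theorem log_partition_ge (hβ : 0 < β) (hd : 0 < d) (n : ℤ) (h : ℝ) :
    Real.log (partitionSOS Λ β n) + h * meanContacts Λ β n ≤ Real.log (partition Λ β n h) := by
  have hZ := partitionSOS_pos Λ hβ hd n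
  set m := h * meanContacts Λ β n with hm
  have hs := summable_exp_hamiltonian Λ hβ hd n
  have hc := summable_contacts Λ hβ hd n
  have key : Real.exp m * partitionSOS Λ β n ≤ partition Λ β n h := by
    have h1 : ∑' φ : Λ → ℤ, (Real.exp m * (1 - m) * Real.exp (-β * hamiltonian Λ n φ)
        + Real.exp m * h * ((contacts φ : ℝ) * Real.exp (-β * hamiltonian Λ n φ)))
        = Real.exp m * partitionSOS Λ β n := by
      rw [(hs.mul_left _).tsum_add (hc.mul_left _), tsum_mul_left, tsum_mul_left]
      have : h * ∑' φ : Λ → ℤ, (contacts φ : ℝ) * Real.exp (-β * hamiltonian Λ n φ)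
          = m * partitionSOS Λ β n := by
        rw [hm, meanContacts]
        field_simp
      rw [mul_assoc (Real.exp m) h, this, partitionSOS]
      ring
    rw [← h1, partition_eq]
    refine ((hs.mul_left _).add (hc.mul_left _)).tsum_le_tsum (fun φ => ?_)
      (summable_partition Λ hβ hd n h)
    rw [← mul_assoc, ← add_mul]
    refine mul_le_mul_of_nonneg_right ?_ (Real.exp_pos _).le
    have h2 := mul_le_mul_of_nonneg_left (Real.add_one_le_exp (h * contacts φ - m))
      (Real.exp_pos m).le
    rw [← Real.exp_add, add_sub_cancel] at h2
    linarith
  have := Real.log_le_log (by positivity) key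
  rw [Real.log_mul (Real.exp_pos _).ne' hZ.ne', Real.log_exp] at this
  linarith

/-- Log-convexity between `0` and `h`. The shift `ρ` gives `exp (h * contacts - ρ)` mean one, so the
pointwise convexity of the exponential between `h * contacts - ρ` and `0` sums to the claim. -/
theorem log_partition_mul_le (hβ : 0 < β) (hd : 0 < d) (n : ℤ) (h : ℝ) {t : ℝ} (ht : t ∈ Set.Icc (0 : ℝ) 1) :
    Real.log (partition Λ β n (t * h))
      ≤ t * Real.log (partition Λ β n h) + (1 - t) * Real.log (partitionSOS Λ β n) := by
  have hZ := partitionSOS_pos Λ hβ hd n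
  have hZh := partition_pos Λ hβ hd n h
  have hZt := partition_pos Λ hβ hd n (t * h)
  set ρ := Real.log (partition Λ β n h) - Real.log (partitionSOS Λ β n) with hρ
  have hs := summable_exp_hamiltonian Λ hβ hd n
  have hsh := summable_partition Λ hβ hd n h
  have key : Real.exp (-(t * ρ)) * partition Λ β n (t * h) ≤ partitionSOS Λ β n := by
    have h1 : ∑' φ : Λ → ℤ, (t * Real.exp (-ρ)
          * (Real.exp (h * contacts φ) * Real.exp (-β * hamiltonian Λ n φ))
        + (1 - t) * Real.exp (-β * hamiltonian Λ n φ)) = partitionSOS Λ β n := by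
      rw [(hsh.mul_left _).tsum_add (hs.mul_left _), tsum_mul_left, tsum_mul_left,
        ← partition_eq, ← partitionSOS, hρ, neg_sub, Real.exp_sub, Real.exp_log hZ,
        Real.exp_log hZh]
      field_simp
      ring
    rw [← h1, partition_eq, ← tsum_mul_left]
    refine ((summable_partition Λ hβ hd n _).mul_left _).tsum_le_tsum (fun φ => ?_)
      ((hsh.mul_left _).add (hs.mul_left _))
    rw [← mul_assoc, ← mul_assoc, ← add_mul]
    refine mul_le_mul_of_nonneg_right ?_ (Real.exp_pos _).le
    have h2 := convexOn_exp.2 (Set.mem_univ (h * contacts φ - ρ)) (Set.mem_univ 0) ht.1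
      (sub_nonneg.2 ht.2) (add_sub_cancel _ _)
    simp only [smul_eq_mul, mul_zero, add_zero, Real.exp_zero, mul_one] at h2
    rw [← Real.exp_add, mul_assoc t (Real.exp _), ← Real.exp_add]
    have e1 : -(t * ρ) + t * h * (contacts φ : ℝ) = t * (h * contacts φ - ρ) := by ring
    have e2 : -ρ + h * contacts φ = h * contacts φ - ρ := by ring
    rwa [e1, e2]
  have := Real.log_le_log (by positivity) key
  rw [Real.log_mul (Real.exp_pos _).ne' hZt.ne', Real.log_exp] at this
  rw [hρ] at this
  linarith

end Convexity

/-- The indicator function of `|ψ x| ≤ K`. -/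
def heightIndicator (K : ℕ) (x : Fin d → ℤ) (ψ : (Fin d → ℤ) → ℤ) : ℝ :=
  if |ψ x| ≤ K then 1 else 0

theorem heightIndicator_mem_Icc (K : ℕ) (x : Fin d → ℤ) (ψ : (Fin d → ℤ) → ℤ) :
    heightIndicator K x ψ ∈ Set.Icc (0 : ℝ) 1 := by
  unfold heightIndicator
  split_ifs <;> simp

section Expectation

variable (Λ : Finset (Fin d → ℤ)) {β : ℝ}

theorem expectation_sum (hβ : 0 < β) (hd : 0 < d) {ι : Type*} (s : Finset ι)
    (f : ι → ((Fin d → ℤ) → ℤ) → ℝ) {M : ℝ} (hf : ∀ i ψ, |f i ψ| ≤ M) :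
    expectation Λ β (fun ψ => ∑ i ∈ s, f i ψ) = ∑ i ∈ s, expectation Λ β (f i) := by
  unfold expectation
  rw [← sum_div, ← Summable.tsum_finsetSum fun i _ =>
    summable_mul_exp_hamiltonian Λ hβ hd 0 (F := fun φ => f i (extend φ)) fun φ => hf i _]
  simp only [sum_mul]

theorem expectation_mono (hβ : 0 < β) (hd : 0 < d) {f g : ((Fin d → ℤ) → ℤ) → ℝ} {M : ℝ}
    (hf : ∀ ψ, |f ψ| ≤ M) (hg : ∀ ψ, |g ψ| ≤ M) (hfg : ∀ ψ, f ψ ≤ g ψ) :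
    expectation Λ β f ≤ expectation Λ β g := by
  unfold expectation
  refine div_le_div_of_nonneg_right ?_ (partitionSOS_pos Λ hβ hd 0).le
  refine Summable.tsum_le_tsum (fun φ => ?_)
    (summable_mul_exp_hamiltonian Λ hβ hd 0 (F := fun φ => f (extend φ)) fun φ => hf _)
    (summable_mul_exp_hamiltonian Λ hβ hd 0 (F := fun φ => g (extend φ)) fun φ => hg _)
  exact mul_le_mul_of_nonneg_right (hfg _) (Real.exp_pos _).le

theorem expectation_const (hβ : 0 < β) (hd : 0 < d) (a : ℝ) :
    expectation Λ β (fun _ => a) = a := by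
  unfold expectation
  rw [tsum_mul_left]
  exact mul_div_cancel_right₀ a (partitionSOS_pos Λ hβ hd 0).ne'

theorem expectation_heightIndicator_mem_Icc (hβ : 0 < β) (hd : 0 < d) (K : ℕ)
    (x : Fin d → ℤ) : expectation Λ β (heightIndicator K x) ∈ Set.Icc (0 : ℝ) 1 := by
  have hb : ∀ ψ : (Fin d → ℤ) → ℤ, |heightIndicator K x ψ| ≤ 1 := fun ψ => by
    rw [abs_of_nonneg (heightIndicator_mem_Icc K x ψ).1]
    exact (heightIndicator_mem_Icc K x ψ).2
  constructor
  · rw [← expectation_const Λ hβ hd 0]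
    exact expectation_mono Λ hβ hd (M := 1) (by simp) hb
      fun ψ => (heightIndicator_mem_Icc K x ψ).1
  · conv_rhs => rw [← expectation_const Λ hβ hd 1]
    exact expectation_mono Λ hβ hd (M := 1) hb (by simp)
      fun ψ => (heightIndicator_mem_Icc K x ψ).2

theorem meanContacts_eq (β : ℝ) (n : ℤ) :
    meanContacts Λ β n
      = expectation Λ β fun ψ => ∑ x ∈ Λ, if ψ x = -n then (1 : ℝ) else 0 := by
  unfold meanContacts expectation
  rw [partitionSOS_shift]
  congr 1
  rw [← (Equiv.addRight (fun _ : Λ => n)).tsum_eq]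
  refine tsum_congr fun φ => ?_
  congr 1
  · beta_reduce
    rw [contacts, ← sum_coe_sort Λ]
    simp only [extend_apply, sum_boole]
    congr 3
    ext x
    simp only [Equiv.coe_addRight, Pi.add_apply]
    omega
  · rw [hamiltonian_shift]
    congr 3
    ext x
    simp

/-- Each site of height at most `K` in absolute value is a contact for exactly one of the shifted
boundary conditions. Averaging over `n` then selects a boundary condition with few contacts or with
many. -/
theorem sum_meanContacts (hβ : 0 < β) (hd : 0 < d) (K : ℕ) :
    ∑ n ∈ Finset.Icc (-(K : ℤ)) K, meanContacts Λ β n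
      = ∑ x ∈ Λ, expectation Λ β (heightIndicator K x) := by
  have hb : ∀ (x : Fin d → ℤ) (n : ℤ) (ψ : (Fin d → ℤ) → ℤ),
      |if ψ x = -n then (1 : ℝ) else 0| ≤ 1 := by
    intro x n ψ
    split_ifs <;> simp
  have h1 : ∀ n, meanContacts Λ β n
      = ∑ x ∈ Λ, expectation Λ β fun ψ => if ψ x = -n then (1 : ℝ) else 0 := by
    intro n
    rw [meanContacts_eq]
    exact expectation_sum Λ hβ hd Λ _ fun x ψ => hb x n ψ
  simp only [h1]
  rw [sum_comm]
  refine sum_congr rfl fun x _ => ?_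
  rw [← expectation_sum Λ hβ hd _ (fun n ψ => if ψ x = -n then (1 : ℝ) else 0)
    fun n ψ => hb x n ψ]
  congr 1
  ext ψ
  have e : ∀ n, (ψ x = -n) ↔ (n = -ψ x) := fun n => by omega
  simp only [e, sum_ite_eq', heightIndicator, Finset.mem_Icc, abs_le]
  exact if_congr (by omega) rfl rfl

end Expectation

/-! ### Bounds on the free energy difference. -/

theorem reducedFreeEnergy_zero (d : ℕ) (β : ℝ) : reducedFreeEnergy d β 0 = 0 := by
  rw [reducedFreeEnergy, freeEnergySOS_eq, sub_self]

theorem tendsto_reducedFreeEnergy (hd : 0 < d) {β : ℝ} (hβ : 0 < β) (h : ℝ) :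
    Tendsto (fun N : ℕ => (Real.log (partition (box d N) β 0 h)
      - Real.log (partitionSOS (box d N) β 0)) / (N : ℝ) ^ d) atTop
      (𝓝 (reducedFreeEnergy d β h)) := by
  simp only [sub_div]
  exact (tendsto_log_partition hd hβ 0 h).sub (tendsto_log_partitionSOS hd hβ 0)

theorem reducedFreeEnergy_mono (hd : 0 < d) {β : ℝ} (hβ : 0 < β) :
    Monotone (reducedFreeEnergy d β) := by
  intro h h' hh
  refine le_of_tendsto_of_tendsto' (tendsto_reducedFreeEnergy hd hβ h)
    (tendsto_reducedFreeEnergy hd hβ h') fun N => ?_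
  have := Real.log_le_log (partition_pos (box d N) hβ hd 0 h)
    (partition_mono (box d N) hβ hd 0 hh)
  gcongr

theorem reducedFreeEnergy_mul_le (hd : 0 < d) {β : ℝ} (hβ : 0 < β) (h : ℝ) {t : ℝ}
    (ht : t ∈ Set.Icc (0 : ℝ) 1) :
    reducedFreeEnergy d β (t * h) ≤ t * reducedFreeEnergy d β h := by
  refine le_of_tendsto_of_tendsto' (tendsto_reducedFreeEnergy hd hβ (t * h))
    ((tendsto_reducedFreeEnergy hd hβ h).const_mul t) fun N => ?_
  have := log_partition_mul_le (box d N) hβ hd 0 h ht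
  rw [← mul_div_assoc]
  gcongr
  linarith

/-- Lower bounds on the free energy from bounds on the mean number of contacts, for some
boundary condition in a fixed range. -/
theorem mul_le_reducedFreeEnergy (hd : 0 < d) {β : ℝ} (hβ : 0 < β) {h κ : ℝ} {K : ℕ}
    {g : ℕ → ℝ} (hg : Tendsto g atTop (𝓝 κ))
    (hK : ∀ N : ℕ, 0 < N → ∃ n ∈ Finset.Icc (-(K : ℤ)) K,
      h * (g N * (N : ℝ) ^ d) ≤ h * meanContacts (box d N) β n) :
    h * κ ≤ reducedFreeEnergy d β h := by
  have hb := (tendsto_boundaryPairs d).const_mul (β * (K : ℝ))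
  rw [mul_zero] at hb
  have hl := (hg.const_mul h).sub hb
  rw [sub_zero] at hl
  refine le_of_tendsto_of_tendsto hl (tendsto_reducedFreeEnergy hd hβ h) ?_
  filter_upwards [eventually_gt_atTop 0] with N hN
  obtain ⟨n, hn, hmean⟩ := hK N hN
  have hN' : (0 : ℝ) < (N : ℝ) ^ d := by positivity
  -- The tangent bound is used with boundary condition `n`, whose free partition function is that of
  -- boundary condition `0`. Returning to `0` in the interacting model costs at most `β * K` per
  -- boundary pair.
  have h1 := log_partition_ge (box d N) hβ hd n h
  have h2 := log_partition_le_log_partition (box d N) hβ hd n 0 h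
  rw [partitionSOS_shift] at h1
  have h3 : |(n : ℝ) - (0 : ℤ)| ≤ K := by
    rw [Finset.mem_Icc] at hn
    rw [Int.cast_zero, sub_zero, abs_le]
    exact ⟨by exact_mod_cast hn.1, by exact_mod_cast hn.2⟩
  have h4 := mul_le_mul_of_nonneg_left
    (mul_le_mul_of_nonneg_right h3 (boundaryPairs_nonneg (box d N))) hβ.le
  rw [le_div_iff₀ hN', sub_mul, mul_assoc, ← mul_div_assoc, div_mul_cancel₀ _ hN'.ne']
  linarith

/-- A repulsive level can be avoided at no volume cost: among many boundary heights, one has a small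
mean density of contacts. -/
theorem reducedFreeEnergy_nonneg (hd : 0 < d) {β : ℝ} (hβ : 0 < β) (h : ℝ) :
    0 ≤ reducedFreeEnergy d β h := by
  rcases le_or_gt 0 h with hh | hh
  · rw [← reducedFreeEnergy_zero d β]
    exact reducedFreeEnergy_mono hd hβ hh
  -- The average over the `2 * K + 1` heights is at most `1 / (2 * K + 1)`; the weaker `1 / (K + 1)`
  -- also tends to zero.
  have key : ∀ K : ℕ, h * (1 / ((K : ℝ) + 1)) ≤ reducedFreeEnergy d β h := by
    intro K
    refine mul_le_reducedFreeEnergy hd hβ (K := K) tendsto_const_nhds fun N hN => ?_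
    have hne : (Finset.Icc (-(K : ℤ)) K).Nonempty := ⟨0, by simp⟩
    have hsum : ∑ n ∈ Finset.Icc (-(K : ℤ)) K, meanContacts (box d N) β n
        ≤ ∑ _n ∈ Finset.Icc (-(K : ℤ)) K, 1 / ((K : ℝ) + 1) * (N : ℝ) ^ d := by
      rw [sum_meanContacts (box d N) hβ hd K]
      have h1 : ∑ x ∈ box d N, expectation (box d N) β (heightIndicator K x) ≤ (N : ℝ) ^ d := by
        calc _ ≤ ∑ _x ∈ box d N, (1 : ℝ) := sum_le_sum fun x _ =>
              (expectation_heightIndicator_mem_Icc (box d N) hβ hd K x).2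
          _ = _ := by simp [card_box]
      refine h1.trans ?_
      have hc : (Finset.Icc (-(K : ℤ)) K).card = 2 * K + 1 := by
        rw [Int.card_Icc]
        omega
      rw [sum_const, hc, nsmul_eq_mul, ← mul_assoc]
      refine le_mul_of_one_le_left (by positivity) ?_
      rw [mul_one_div, le_div_iff₀ (by positivity)]
      push_cast
      linarith [(Nat.cast_nonneg K : (0 : ℝ) ≤ K)]
    obtain ⟨n, hn, hle⟩ := exists_le_of_sum_le hne hsum
    exact ⟨n, hn, mul_le_mul_of_nonpos_left hle hh.le⟩
  have hlim : Tendsto (fun K : ℕ => h * (1 / ((K : ℝ) + 1))) atTop (𝓝 0) := by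
    simpa using (tendsto_one_div_add_atTop_nhds_zero_nat (𝕜 := ℝ)).const_mul h
  exact le_of_tendsto' hlim key

theorem reducedFreeEnergy_of_nonpos (hd : 0 < d) {β : ℝ} (hβ : 0 < β) {h : ℝ} (hh : h ≤ 0) :
    reducedFreeEnergy d β h = 0 := by
  refine le_antisymm ?_ (reducedFreeEnergy_nonneg hd hβ h)
  rw [← reducedFreeEnergy_zero d β]
  exact reducedFreeEnergy_mono hd hβ hh

/-- In the boxes the heights of the bulk sites are bounded by a constant with a probability
bounded from below. -/
def IsTight (d : ℕ) (β : ℝ) : Prop :=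
  ∃ (K R : ℕ) (δ : ℝ), 0 < δ ∧ ∀ N : ℕ, ∀ x ∈ bulk d N R,
    δ ≤ expectation (box d N) β (heightIndicator K x)

/-- The bulk fills almost the whole box, so the contacts summed over the `2 * K + 1` boundary
heights have density at least about `δ`, and one height carries an average share. -/
theorem IsTight.exists_mul_le (hd : 0 < d) {β : ℝ} (hβ : 0 < β) (ht : IsTight d β) :
    ∃ κ : ℝ, 0 < κ ∧ ∀ h, 0 ≤ h → κ * h ≤ reducedFreeEnergy d β h := by
  obtain ⟨K, R, δ, hδ, hx⟩ := ht
  refine ⟨δ / (2 * K + 1), by positivity, fun h hh => ?_⟩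
  rw [mul_comm]
  have hlim : Tendsto (fun N : ℕ => δ / (2 * K + 1) * (((bulk d N R).card : ℝ) / (N : ℝ) ^ d))
      atTop (𝓝 (δ / (2 * K + 1))) := by
    simpa using (tendsto_card_bulk (d := d) R).const_mul (δ / (2 * (K : ℝ) + 1))
  refine mul_le_reducedFreeEnergy hd hβ (K := K) hlim fun N hN => ?_
  have hN' : (0 : ℝ) < (N : ℝ) ^ d := by positivity
  have hne : (Finset.Icc (-(K : ℤ)) K).Nonempty := ⟨0, by simp⟩
  have hsum : ∑ _n ∈ Finset.Icc (-(K : ℤ)) K, δ / (2 * K + 1) * ((bulk d N R).card : ℝ)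
      ≤ ∑ n ∈ Finset.Icc (-(K : ℤ)) K, meanContacts (box d N) β n := by
    rw [sum_meanContacts (box d N) hβ hd K]
    have hc : (Finset.Icc (-(K : ℤ)) K).card = 2 * K + 1 := by
      rw [Int.card_Icc]
      omega
    calc _ = ∑ x ∈ bulk d N R, δ := by
          rw [sum_const, sum_const, hc, nsmul_eq_mul, nsmul_eq_mul]
          push_cast
          field_simp
      _ ≤ ∑ x ∈ bulk d N R, expectation (box d N) β (heightIndicator K x) :=
          sum_le_sum fun x h => hx N x h
      _ ≤ _ := sum_le_sum_of_subset_of_nonneg (bulk_subset_box N R) fun x _ _ =>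
          (expectation_heightIndicator_mem_Icc (box d N) hβ hd K x).1
  obtain ⟨n, hn, hle⟩ := exists_le_of_sum_le hne hsum
  refine ⟨n, hn, mul_le_mul_of_nonneg_left ?_ hh⟩
  rwa [mul_assoc, div_mul_cancel₀ _ hN'.ne']

/-! ### From a linear lower bound to the first-order transition. -/

section Transition

variable {F : ℝ → ℝ} {κ : ℝ}

/-- The scaling hypothesis makes `F h / h` nondecreasing on the positive half-line. Its limit at
`0+` is thus its infimum, which is at least `κ`. -/
theorem exists_isEquivalent_of_mul_le (hF : ∀ h, 0 < h → ∀ t ∈ Set.Icc (0 : ℝ) 1,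
    F (t * h) ≤ t * F h) (hκ : 0 < κ) (hκF : ∀ h, 0 ≤ h → κ * h ≤ F h) :
    ∃ c : ℝ, 0 < c ∧ Asymptotics.IsEquivalent (𝓝[>] 0) F fun h => c * h := by
  set S : Set ℝ := (fun h => F h / h) '' Set.Ioi 0 with hS
  have hbdd : ∀ s ∈ S, κ ≤ s := by
    rintro _ ⟨h, hh, rfl⟩
    exact (le_div_iff₀ hh).2 (hκF h (le_of_lt hh))
  have hne : S.Nonempty := Set.nonempty_Ioi.image _
  have hc : κ ≤ sInf S := le_csInf hne hbdd
  have hpos : 0 < sInf S := hκ.trans_le hc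
  refine ⟨sInf S, hpos, ?_⟩
  have hlim : Tendsto (fun h => F h / h) (𝓝[>] 0) (𝓝 (sInf S)) := by
    refine tendsto_order.2 ⟨fun b hb => ?_, fun b hb => ?_⟩
    · filter_upwards [self_mem_nhdsWithin] with h hh
      exact hb.trans_le (csInf_le ⟨κ, hbdd⟩ ⟨h, hh, rfl⟩)
    · obtain ⟨_, ⟨h, hh, rfl⟩, hlt⟩ := exists_lt_of_csInf_lt hne hb
      have hh' : (0 : ℝ) < h := hh
      filter_upwards [Ioo_mem_nhdsGT hh'] with u hu
      refine lt_of_le_of_lt ?_ hlt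
      have hu0 : 0 < u := hu.1
      have := hF h hh' (u / h) ⟨by positivity, (div_le_one hh').2 hu.2.le⟩
      rw [div_mul_cancel₀ _ hh'.ne'] at this
      rw [div_le_iff₀ hu0]
      calc F u ≤ u / h * F h := this
        _ = F h / h * u := by ring
  rw [Asymptotics.isEquivalent_iff_tendsto_one]
  · have := hlim.div_const (sInf S)
    rw [div_self hpos.ne'] at this
    refine this.congr fun h => ?_
    rw [Pi.div_apply, div_div, mul_comm]
  · filter_upwards [self_mem_nhdsWithin] with h hh
    exact (mul_pos hpos hh).ne'

/-- A derivative at `0` would be zero from the left and at least `κ` from the right. -/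
theorem not_differentiableAt_of_mul_le (hF0 : ∀ h, h ≤ 0 → F h = 0) (hκ : 0 < κ)
    (hκF : ∀ h, 0 ≤ h → κ * h ≤ F h) : ¬ DifferentiableAt ℝ F 0 := by
  intro hdiff
  have hslope := hasDerivAt_iff_tendsto_slope.1 hdiff.hasDerivAt
  have hF00 := hF0 0 le_rfl
  have hleft : deriv F 0 = 0 := by
    have h1 := hslope.mono_left (nhdsWithin_mono 0 (s := Set.Iio 0) fun x hx => ne_of_lt hx)
    refine tendsto_nhds_unique (h1.congr' ?_) tendsto_const_nhds
    filter_upwards [self_mem_nhdsWithin] with h hh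
    rw [slope_def_field, hF0 h (le_of_lt hh), hF00]
    simp
  have hright : κ ≤ deriv F 0 := by
    have h1 := hslope.mono_left (nhdsWithin_mono 0 (s := Set.Ioi 0) fun x hx => ne_of_gt hx)
    refine ge_of_tendsto h1 ?_
    filter_upwards [self_mem_nhdsWithin] with h hh
    rw [slope_def_field, hF00, sub_zero, sub_zero]
    exact (le_div_iff₀ hh).2 (hκF h (le_of_lt hh))
  linarith

end Transition

theorem criticalPoint_eq_zero (hd : 0 < d) {β κ : ℝ} (hβ : 0 < β) (hκ : 0 < κ)
    (hκF : ∀ h, 0 ≤ h → κ * h ≤ reducedFreeEnergy d β h) : criticalPoint d β = 0 := by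
  apply le_antisymm
  · refine EReal.le_of_forall_lt_iff_le.1 fun z hz => ?_
    have hz' : (0 : ℝ) < z := by exact_mod_cast hz
    exact sInf_le ⟨z, rfl, (mul_pos hκ hz').trans_le (hκF z hz'.le)⟩
  · refine le_sInf ?_
    rintro _ ⟨h, rfl, hpos⟩
    by_contra hlt
    have : h < 0 := by
      rw [not_le] at hlt
      exact_mod_cast hlt
    rw [reducedFreeEnergy_of_nonpos hd hβ this.le] at hpos
    exact lt_irrefl _ hpos

/-! ### Tightness from rigidity. -/

theorem boundary_nonempty (hd : 0 < d) {Λ : Finset (Fin d → ℤ)} (hΛ : Λ.Nonempty) :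
    (boundary Λ).Nonempty := by
  obtain ⟨x, hx, hmax⟩ := Λ.exists_max_image (fun x => x ⟨0, hd⟩) hΛ
  refine ⟨x + unitVec ⟨0, hd⟩, (mem_boundary _ _).2 ⟨fun h => ?_, x, hx, adj_add_unitVec x _⟩⟩
  have := hmax _ h
  simp [unitVec] at this

/-- The boundary must be known to be non-empty, because the infimum of an empty set of naturals is
`0`. -/
theorem le_setDist (hd : 0 < d) {Λ : Finset (Fin d → ℤ)} {x : Fin d → ℤ} (hx : x ∈ Λ) {R : ℕ}
    (hR : ∀ y ∈ boundary Λ, R ≤ l1dist y x) : R ≤ setDist (boundary Λ) {x} := by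
  obtain ⟨y, hy⟩ := boundary_nonempty hd ⟨x, hx⟩
  refine le_csInf ⟨_, y, hy, x, mem_singleton_self x, rfl⟩ ?_
  rintro _ ⟨z, hz, w, hw, rfl⟩
  rw [mem_singleton.1 hw]
  exact hR z hz

theorem le_l1dist_of_mem_bulk {N R : ℕ} {x y : Fin d → ℤ} (hx : x ∈ bulk d N R)
    (hy : y ∈ boundary (box d N)) : R ≤ l1dist y x := by
  have hy' := ((mem_boundary _ _).1 hy).1
  rw [mem_box] at hy'
  push Not at hy'
  obtain ⟨i, hi⟩ := hy'
  have h1 := mem_bulk.1 hx i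
  have h2 : (y i - x i).natAbs ≤ l1dist y x :=
    single_le_sum (f := fun i => (y i - x i).natAbs) (fun _ _ => Nat.zero_le _) (mem_univ i)
  omega

/-- Near `β` the terms are dominated by the summable weights at inverse temperature `β / 2`. -/
theorem continuousAt_tsum_mul_exp (Λ : Finset (Fin d → ℤ)) {β : ℝ} (hβ : 0 < β) (hd : 0 < d)
    {F : (Λ → ℤ) → ℝ} {M : ℝ} (hF : ∀ φ, |F φ| ≤ M) :
    ContinuousAt (fun β => ∑' φ : Λ → ℤ, F φ * Real.exp (-β * hamiltonian Λ 0 φ)) β := by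
  have hM : 0 ≤ M := (abs_nonneg _).trans (hF 0)
  have hs : Set.Ioi (β / 2) ∈ 𝓝 β := Ioi_mem_nhds (by linarith)
  refine ContinuousOn.continuousAt (continuousOn_tsum
    (u := fun φ => M * Real.exp (-(β / 2) * hamiltonian Λ 0 φ)) (fun φ => ?_)
    ((summable_exp_hamiltonian Λ (half_pos hβ) hd 0).mul_left M) fun φ b hb => ?_) hs
  · fun_prop
  · rw [Real.norm_eq_abs, abs_mul, abs_of_pos (Real.exp_pos _)]
    refine mul_le_mul (hF φ) (Real.exp_le_exp.2 ?_) (Real.exp_pos _).le hM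
    have := mul_le_mul_of_nonneg_right (le_of_lt (Set.mem_Ioi.1 hb)) (hamiltonian_nonneg Λ 0 φ)
    linarith

theorem continuousAt_expectation (Λ : Finset (Fin d → ℤ)) {β : ℝ} (hβ : 0 < β) (hd : 0 < d)
    {f : ((Fin d → ℤ) → ℤ) → ℝ} {M : ℝ} (hf : ∀ ψ, |f ψ| ≤ M) :
    ContinuousAt (fun β => expectation Λ β f) β := by
  unfold expectation
  refine (continuousAt_tsum_mul_exp Λ hβ hd (F := fun φ => f (extend φ)) fun φ => hf _).div ?_
    (partitionSOS_pos Λ hβ hd 0).ne'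
  have := continuousAt_tsum_mul_exp Λ hβ hd (F := fun _ => 1) (M := 1) (by simp)
  simpa [partitionSOS] using this

theorem abs_heightIndicator_le (K : ℕ) (x : Fin d → ℤ) (ψ : (Fin d → ℤ) → ℤ) :
    |heightIndicator K x ψ| ≤ 1 := by
  rw [abs_of_nonneg (heightIndicator_mem_Icc K x ψ).1]
  exact (heightIndicator_mem_Icc K x ψ).2

theorem tendsto_expectation_heightIndicator (Λ : Finset (Fin d → ℤ)) {β : ℝ} (hβ : 0 < β)
    (hd : 0 < d) (x : Fin d → ℤ) :
    Tendsto (fun K : ℕ => expectation Λ β (heightIndicator K x)) atTop (𝓝 1) := by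
  have hZ := partitionSOS_pos Λ hβ hd 0
  have h1 : Tendsto (fun K : ℕ => ∑' φ : Λ → ℤ,
      heightIndicator K x (extend φ) * Real.exp (-β * hamiltonian Λ 0 φ)) atTop
      (𝓝 (∑' φ : Λ → ℤ, Real.exp (-β * hamiltonian Λ 0 φ))) := by
    refine tendsto_tsum_of_dominated_convergence (summable_exp_hamiltonian Λ hβ hd 0)
      (fun φ => ?_) (Eventually.of_forall fun K φ => ?_)
    · refine tendsto_const_nhds.congr' ?_
      filter_upwards [eventually_ge_atTop (extend φ x).natAbs] with K hK
      rw [heightIndicator, if_pos (abs_le.2 (by omega)), one_mul]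
    · rw [Real.norm_eq_abs, abs_mul, abs_of_pos (Real.exp_pos _)]
      exact mul_le_of_le_one_left (Real.exp_pos _).le (abs_heightIndicator_le K x _)
  have := h1.div_const (partitionSOS Λ β 0)
  rwa [← partitionSOS, div_self hZ.ne'] at this

/-- The limiting measure serves only as an intermediary between two finite domains. The resulting
comparison no longer mentions it and is continuous in `β`, so it extends to `β = β₀`. -/
theorem IsRigidityThreshold.isTight {β₀ : ℝ} (hrig : IsRigidityThreshold d β₀) (hd : 0 < d)
    {β : ℝ} (hβ : β₀ ≤ β) : IsTight d β := by
  obtain ⟨hβ₀, c, hc, hP⟩ := hrig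
  have hβ' : 0 < β := hβ₀.trans_le hβ
  -- Stated with `β₀`, so that one `R` serves every `b > β₀`; two errors of `1 / 8` give the `1 / 4`
  -- below.
  obtain ⟨R, hR⟩ : ∃ R : ℕ, Real.exp (-(c * β₀ * R)) ≤ 1 / 8 := by
    have h1 : Tendsto (fun R : ℕ => Real.exp (-(c * β₀ * R))) atTop (𝓝 0) :=
      Real.tendsto_exp_neg_atTop_nhds_zero.comp
        (tendsto_natCast_atTop_atTop.const_mul_atTop (mul_pos hc hβ₀))
    exact (h1.eventually (ge_mem_nhds (by norm_num))).exists
  have hclose : ∀ (Λ Λ' : Finset (Fin d → ℤ)) (x : Fin d → ℤ) (K : ℕ), x ∈ Λ → x ∈ Λ' →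
      (∀ y ∈ boundary Λ, R ≤ l1dist y x) → (∀ y ∈ boundary Λ', R ≤ l1dist y x) →
      expectation Λ' β (heightIndicator K x) - expectation Λ β (heightIndicator K x)
        ≤ 1 / 4 := by
    intro Λ Λ' x K hx hx' hΛ hΛ'
    have hcont : ContinuousAt (fun b => expectation Λ' b (heightIndicator K x)
        - expectation Λ b (heightIndicator K x)) β :=
      (continuousAt_expectation Λ' hβ' hd (abs_heightIndicator_le K x)).sub
        (continuousAt_expectation Λ hβ' hd (abs_heightIndicator_le K x))
    -- Rigidity is available only strictly above `β₀`, so the bound is proved for `b > β` and passed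
    -- to the limit `b ↓ β`.
    refine le_of_tendsto (hcont.tendsto.mono_left (nhdsWithin_le_nhds (s := Set.Ioi β))) ?_
    filter_upwards [self_mem_nhdsWithin] with b hb
    have hb₀ : β₀ < b := hβ.trans_lt hb
    obtain ⟨P, -, hP⟩ := hP b hb₀
    have hdep : DependsOn (heightIndicator K x) (({x} : Finset (Fin d → ℤ)) : Set _) := by
      intro ψ ψ' h
      rw [heightIndicator, heightIndicator, h x (by simp)]
    have key : ∀ Λ : Finset (Fin d → ℤ), x ∈ Λ → (∀ y ∈ boundary Λ, R ≤ l1dist y x) →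
        |expectation Λ b (heightIndicator K x) - ∫ φ, heightIndicator K x φ ∂P| ≤ 1 / 8 := by
      intro Λ hx hΛ
      refine (hP {x} (heightIndicator K x) (singleton_nonempty x)
        (heightIndicator_mem_Icc K x) hdep Λ (singleton_subset_iff.2 hx)).trans
        (le_trans ?_ hR)
      rw [card_singleton, Nat.cast_one, one_mul]
      refine Real.exp_le_exp.2 (neg_le_neg ?_)
      have : (R : ℝ) ≤ setDist (boundary Λ) {x} := by exact_mod_cast le_setDist hd hx hΛ
      have hcb : 0 ≤ c * b := (mul_pos hc (hβ₀.trans hb₀)).le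
      gcongr
    have h1 := abs_le.1 (key Λ hx hΛ)
    have h2 := abs_le.1 (key Λ' hx' hΛ')
    linarith [h1.1, h1.2, h2.1, h2.2]
  -- The centre of the box of side `2 * R + 1`, the smallest with a site at depth `R`. A level `K`
  -- of probability above `1 / 2` there keeps probability at least `1 / 4` at every bulk site.
  set x₀ : Fin d → ℤ := fun _ => R + 1 with hx₀
  have hx₀bulk : x₀ ∈ bulk d (2 * R + 1) R := by
    rw [mem_bulk]
    intro i
    simp only [hx₀]
    push_cast
    constructor <;> linarith
  obtain ⟨K, hK⟩ := ((tendsto_expectation_heightIndicator (box d (2 * R + 1)) hβ' hd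
    x₀).eventually (lt_mem_nhds (show (1 / 2 : ℝ) < 1 by norm_num))).exists
  refine ⟨K, R, 1 / 4, by norm_num, fun N x hx => ?_⟩
  have hmem : x ∈ translate (box d (2 * R + 1)) (x - x₀) := by
    rw [mem_translate, sub_sub_cancel]
    exact bulk_subset_box _ _ hx₀bulk
  have h1 := hclose (box d N) (translate (box d (2 * R + 1)) (x - x₀)) x K
    (bulk_subset_box _ _ hx) hmem (fun y hy => le_l1dist_of_mem_bulk hx hy) (fun y hy => ?_)
  · rw [expectation_translate] at h1
    have e : (fun ψ : (Fin d → ℤ) → ℤ => heightIndicator K x fun y => ψ (y - (x - x₀)))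
        = heightIndicator K x₀ := by
      funext ψ
      simp [heightIndicator]
    rw [e] at h1
    linarith
  · rw [boundary_translate, mem_translate] at hy
    have := le_l1dist_of_mem_bulk hx₀bulk hy
    rw [← l1dist_sub (x - x₀) y x]
    simpa using this

end SOS

/-! ### Edge boundaries and plaquette connectedness of minimal contours. -/

namespace SOS

open Finset

variable {d : ℕ}

/-- The edges of `ℤ^d` on the boundary of `U`; the pair `(y, i)` encodes the edge between `y`
and `y + unitVec i`. -/
def edgeBoundary (U : Finset (Fin d → ℤ)) : Finset ((Fin d → ℤ) × Fin d) :=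
  (U.biUnion fun y => univ.biUnion fun i => {(y, i), (y - unitVec i, i)}).filter
    fun e => ¬ (e.1 ∈ U ↔ e.1 + unitVec e.2 ∈ U)

theorem mem_edgeBoundary {U : Finset (Fin d → ℤ)} {e : (Fin d → ℤ) × Fin d} :
    e ∈ edgeBoundary U ↔ ¬ (e.1 ∈ U ↔ e.1 + unitVec e.2 ∈ U) := by
  obtain ⟨y, i⟩ := e
  simp only [edgeBoundary, mem_filter, mem_biUnion, mem_univ, true_and, mem_insert,
    mem_singleton, Prod.mk.injEq, and_iff_right_iff_imp]
  intro h
  by_cases hy : y ∈ U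
  · exact ⟨y, hy, i, Or.inl ⟨rfl, rfl⟩⟩
  · have hy' : y + unitVec i ∈ U := by tauto
    exact ⟨_, hy', i, Or.inr ⟨(add_sub_cancel_right _ _).symm, rfl⟩⟩

theorem unitVec_apply_ne_zero (i : Fin d) : unitVec i i ≠ 0 := by simp [unitVec]

theorem exists_exit {U : Finset (Fin d → ℤ)} {y : Fin d → ℤ} (hy : y ∈ U)
    {v : Fin d → ℤ} {i : Fin d} (hv : v i ≠ 0) :
    ∃ m : ℕ, (∀ j ≤ m, y + j • v ∈ U) ∧ y + (m + 1) • v ∉ U := by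
  classical
  have hex : ∃ m : ℕ, y + m • v ∉ U := by
    by_contra! hall
    have hinj : Function.Injective fun m : ℕ => (⟨_, hall m⟩ : U) := by
      intro k l hkl
      have := congrFun (congrArg Subtype.val hkl) i
      simpa [hv] using this
    exact not_injective_infinite_finite _ hinj
  have hne : Nat.find hex ≠ 0 := by
    intro h0
    have := Nat.find_spec hex
    rw [h0, zero_smul, add_zero] at this
    exact this hy
  obtain ⟨m, hm⟩ := Nat.exists_eq_succ_of_ne_zero hne
  refine ⟨m, fun j hj => ?_, ?_⟩
  · by_contra hc
    have := Nat.find_min' hex hc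
    omega
  · have := Nat.find_spec hex
    rwa [hm] at this

theorem exit_mem_edgeBoundary {U : Finset (Fin d → ℤ)} {y : Fin d → ℤ} {i : Fin d} {m : ℕ}
    (h : y + m • unitVec i ∈ U) (h' : y + (m + 1) • unitVec i ∉ U) :
    (y + m • unitVec i, i) ∈ edgeBoundary U := by
  rw [mem_edgeBoundary]
  rw [add_smul, one_smul, ← add_assoc] at h'
  exact fun hiff => h' (hiff.1 h)

theorem eq_empty_of_edgeBoundary_eq_empty (hd : 0 < d) {U : Finset (Fin d → ℤ)}
    (h : edgeBoundary U = ∅) : U = ∅ := by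
  by_contra hne
  obtain ⟨y, hy⟩ := nonempty_iff_ne_empty.2 hne
  obtain ⟨m, hm, hm'⟩ := exists_exit hy (unitVec_apply_ne_zero ⟨0, hd⟩)
  have := exit_mem_edgeBoundary (hm m le_rfl) hm'
  simp [h] at this

/-- An edge on the boundary of the symmetric difference lies on exactly one of the two boundaries. A
finite set without boundary edges is empty, as a ray from any of its points must leave it. -/
theorem edgeBoundary_injective (hd : 0 < d) :
    Function.Injective (edgeBoundary : Finset (Fin d → ℤ) → _) := by
  intro U V h
  have h0 : edgeBoundary (symmDiff U V) = ∅ := by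
    ext e
    have := Finset.ext_iff.1 h e
    simp only [mem_edgeBoundary, mem_symmDiff, notMem_empty, iff_false] at this ⊢
    tauto
  exact symmDiff_eq_bot.1 (eq_empty_of_edgeBoundary_eq_empty hd h0)

section Potential

variable {A : Type*} [AddCommGroup A] {α : (Fin d → ℤ) → Fin d → A} {o : Fin d} {R : ℤ}

/-- The potential of a field on the edges, obtained by integration in the direction `o`. -/
def potential (α : (Fin d → ℤ) → Fin d → A) (o : Fin d) (R : ℤ) (y : Fin d → ℤ) : A :=
  ∑ k ∈ range (y o + R).toNat, α (Function.update y o (-R + k)) o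

/-- The discrete Poincaré lemma: `hα` says that the field is closed around each plaquette, and
integration starts below its support. In direction `o` the sum gains one term; in any other
direction closedness turns the difference of the two sums into a telescoping one. -/
theorem potential_add_unitVec
    (hR : ∀ y i j, α y i ≠ 0 → |y j| < R)
    (hα : ∀ y i j, α y i + α (y + unitVec i) j = α y j + α (y + unitVec j) i)
    (y : Fin d → ℤ) (i : Fin d) :
    potential α o R (y + unitVec i) = potential α o R y + α y i := by
  have hzero : ∀ y i, y o ≤ -R → α y i = 0 := by
    intro y i hy
    by_contra hne
    have := abs_lt.1 (hR y i o hne)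
    omega
  by_cases hi : i = o
  · subst hi
    have hup : ∀ t, Function.update (y + unitVec i) i t = Function.update y i t := by
      intro t
      ext j
      by_cases hj : j = i
      · subst hj; simp
      · simp [hj, unitVec]
    simp only [potential, hup, Pi.add_apply, unitVec, Pi.single_eq_same]
    rcases lt_or_ge (y i) (-R) with hy | hy
    · rw [hzero y i hy.le, show (y i + 1 + R).toNat = 0 by omega,
        show (y i + R).toNat = 0 by omega]
      simp
    · rw [show (y i + 1 + R).toNat = (y i + R).toNat + 1 by omega, sum_range_succ,
        show -R + ((y i + R).toNat : ℤ) = y i by omega, Function.update_eq_self]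
  · have ho : (y + unitVec i) o = y o := by simp [unitVec, Pi.single_eq_of_ne (Ne.symm hi)]
    have hup : ∀ t, Function.update (y + unitVec i) o t = Function.update y o t + unitVec i := by
      intro t
      ext j
      by_cases hj : j = o
      · subst hj; simp [unitVec, Pi.single_eq_of_ne (Ne.symm hi)]
      · simp [hj]
    have hup' : ∀ t, Function.update y o t + unitVec o = Function.update y o (t + 1) := by
      intro t
      ext j
      by_cases hj : j = o
      · subst hj; simp
      · simp [hj, unitVec]
    simp only [potential, ho, hup]
    have hstep : ∀ k : ℕ, α (Function.update y o (-R + k) + unitVec i) o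
        = α (Function.update y o (-R + k)) o
          + (α (Function.update y o (-R + (k + 1 : ℕ))) i
            - α (Function.update y o (-R + k)) i) := by
      intro k
      have := hα (Function.update y o (-R + k)) o i
      rw [hup', add_assoc] at this
      push_cast
      rw [← add_sub_assoc, this, add_sub_cancel_left]
    simp only [hstep, sum_add_distrib]
    rw [sum_range_sub fun k : ℕ => α (Function.update y o (-R + k)) i]
    rw [hzero (Function.update y o (-R + (0 : ℕ))) i (by simp), sub_zero]
    rcases lt_or_ge (y o) (-R) with hy | hy
    · rw [hzero y i hy.le, hzero]
      rw [show (y o + R).toNat = 0 by omega]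
      simp
    · rw [show -R + ((y o + R).toNat : ℤ) = y o by omega, Function.update_eq_self]

/-- A second direction `p` is essential. Far out in direction `o` the field vanishes, so the point
can be moved along `p` without changing the potential, until its whole line of integration misses
the support. -/
theorem potential_eq_zero
    (hR : ∀ y i j, α y i ≠ 0 → |y j| < R)
    (hα : ∀ y i j, α y i + α (y + unitVec i) j = α y j + α (y + unitVec j) i)
    {p : Fin d} (hp : p ≠ o) {y : Fin d → ℤ} {j : Fin d} (hy : R ≤ |y j|) :
    potential α o R y = 0 := by
  have hside : ∀ (y : Fin d → ℤ) (j : Fin d), j ≠ o → R ≤ |y j| → potential α o R y = 0 := by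
    intro y j hj hy
    refine sum_eq_zero fun k _ => ?_
    by_contra hne
    have := hR _ _ j hne
    rw [Function.update_of_ne hj] at this
    omega
  by_cases hj : j = o
  · subst hj
    have hmove : ∀ k : ℕ, potential α j R (y + k • unitVec p) = potential α j R y := by
      intro k
      induction k with
      | zero => simp
      | succ k ih =>
        rw [add_smul, one_smul, ← add_assoc, potential_add_unitVec hR hα, ih]
        have : α (y + k • unitVec p) p = 0 := by
          by_contra hne
          have := hR _ _ j hne
          simp [unitVec, Pi.single_eq_of_ne (Ne.symm hp)] at this
          omega
        rw [this, add_zero]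
    rw [← hmove (R - y p).toNat]
    apply hside _ p hp
    have : R ≤ (y + (R - y p).toNat • unitVec p) p := by
      simp [unitVec]
      omega
    exact this.trans (le_abs_self _)
  · exact hside y j hj hy

end Potential

/-- The edges of the plaquette at `y` in the directions `i` and `j`. -/
def plaquette (y : Fin d → ℤ) (i j : Fin d) : Finset ((Fin d → ℤ) × Fin d) :=
  {(y, i), (y + unitVec i, j), (y, j), (y + unitVec j, i)}

/-- A set of edges with an even number of edges in each plaquette bounds a finite set. -/
theorem exists_edgeBoundary_eq (hd : 2 ≤ d) (E : Finset ((Fin d → ℤ) × Fin d))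
    (hE : ∀ y i j, (if (y, i) ∈ E then (1 : ZMod 2) else 0)
        + (if (y + unitVec i, j) ∈ E then 1 else 0)
      = (if (y, j) ∈ E then 1 else 0) + (if (y + unitVec j, i) ∈ E then 1 else 0)) :
    ∃ G : Finset (Fin d → ℤ), edgeBoundary G = E := by
  set α : (Fin d → ℤ) → Fin d → ZMod 2 := fun y i => if (y, i) ∈ E then 1 else 0 with hα
  obtain ⟨R, hR⟩ : ∃ R : ℤ, ∀ y i j, α y i ≠ 0 → |y j| < R := by
    obtain ⟨M, hM⟩ := ((E ×ˢ univ).image fun q : ((Fin d → ℤ) × Fin d) × Fin d =>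
      |q.1.1 q.2|).exists_le
    refine ⟨M + 1, fun y i j hne => Int.lt_add_one_of_le (hM _ (mem_image.2
      ⟨((y, i), j), mem_product.2 ⟨?_, mem_univ j⟩, rfl⟩))⟩
    by_contra h
    exact hne (if_neg h)
  let o : Fin d := ⟨0, by omega⟩
  let p : Fin d := ⟨1, by omega⟩
  have hpo : p ≠ o := by simp [p, o, Fin.ext_iff]
  set g := potential α o R with hg
  -- The set is the level set of the potential modulo two, finite because the potential vanishes
  -- outside this cube.
  refine ⟨(Finset.Icc (fun _ => -R) (fun _ => R)).filter fun y => g y = 1, ?_⟩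
  have hmem : ∀ y, y ∈ (Finset.Icc (fun _ : Fin d => -R) (fun _ => R)).filter
      (fun y => g y = 1) ↔ g y = 1 := by
    intro y
    rw [mem_filter, and_iff_right_iff_imp]
    intro hy
    have : ∀ j, |y j| < R := by
      intro j
      by_contra! hc
      rw [hg, potential_eq_zero hR hE hpo hc] at hy
      exact zero_ne_one hy
    rw [Finset.mem_Icc, Pi.le_def, Pi.le_def]
    exact ⟨fun j => (abs_lt.1 (this j)).1.le, fun j => (abs_lt.1 (this j)).2.le⟩
  ext ⟨y, i⟩
  rw [mem_edgeBoundary, hmem, hmem]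
  simp only
  rw [hg, potential_add_unitVec hR hE, ← hg]
  have hαE : (y, i) ∈ E ↔ α y i = 1 := by
    by_cases h : (y, i) ∈ E <;> simp [hα, h]
  rw [hαE]
  generalize g y = a
  generalize α y i = b
  revert a b
  decide

/-- A set `E` of edges is plaquette connected if it is not a disjoint union of two non-empty
sets that no plaquette meets both. -/
def PlaquetteConnected (E : Finset ((Fin d → ℤ) × Fin d)) : Prop :=
  ∀ E' ⊆ E, E'.Nonempty → E' ≠ E →
    ∃ a ∈ E', ∃ b ∈ E \ E', ∃ y i j, a ∈ plaquette y i j ∧ b ∈ plaquette y i j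

/-- A plaquette that meets `E` contains the same edges of `E` as of the full boundary. So the parity
condition passes from the boundary of `U`, where it is automatic, to `E`. -/
theorem exists_edgeBoundary_eq_of_saturated (hd : 2 ≤ d) {U : Finset (Fin d → ℤ)}
    {E : Finset ((Fin d → ℤ) × Fin d)} (hE : E ⊆ edgeBoundary U)
    (hsat : ∀ a ∈ E, ∀ b ∈ edgeBoundary U \ E, ∀ y i j,
      ¬ (a ∈ plaquette y i j ∧ b ∈ plaquette y i j)) :
    ∃ G : Finset (Fin d → ℤ), edgeBoundary G = E := by
  refine exists_edgeBoundary_eq hd E fun y i j => ?_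
  have hU : (if (y, i) ∈ edgeBoundary U then (1 : ZMod 2) else 0)
        + (if (y + unitVec i, j) ∈ edgeBoundary U then 1 else 0)
      = (if (y, j) ∈ edgeBoundary U then 1 else 0)
        + (if (y + unitVec j, i) ∈ edgeBoundary U then 1 else 0) := by
    have key : ∀ z k, (if (z, k) ∈ edgeBoundary U then (1 : ZMod 2) else 0)
        = (if z ∈ U then 1 else 0) + (if z + unitVec k ∈ U then 1 else 0) := by
      intro z k
      by_cases h1 : z ∈ U <;> by_cases h2 : z + unitVec k ∈ U <;>
        simp [mem_edgeBoundary, h1, h2]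
      decide
    simp only [key]
    rw [add_right_comm y (unitVec j)]
    generalize (if y ∈ U then (1 : ZMod 2) else 0) = a
    generalize (if y + unitVec i ∈ U then (1 : ZMod 2) else 0) = b
    generalize (if y + unitVec j ∈ U then (1 : ZMod 2) else 0) = c
    generalize (if y + unitVec i + unitVec j ∈ U then (1 : ZMod 2) else 0) = e
    revert a b c e
    decide
  by_cases hmeet : ∃ a ∈ E, a ∈ plaquette y i j
  · obtain ⟨a, ha, hap⟩ := hmeet
    have hiff : ∀ b ∈ plaquette y i j, b ∈ E ↔ b ∈ edgeBoundary U := by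
      intro b hb
      refine ⟨fun h => hE h, fun h => ?_⟩
      by_contra hbE
      exact hsat a ha b (mem_sdiff.2 ⟨h, hbE⟩) y i j ⟨hap, hb⟩
    rw [if_congr (hiff (y, i) (by simp [plaquette])) rfl rfl,
      if_congr (hiff (y + unitVec i, j) (by simp [plaquette])) rfl rfl,
      if_congr (hiff (y, j) (by simp [plaquette])) rfl rfl,
      if_congr (hiff (y + unitVec j, i) (by simp [plaquette])) rfl rfl]
    exact hU
  · push Not at hmeet
    have hnot : ∀ b ∈ plaquette y i j, b ∉ E := fun b hb hbE => hmeet b hbE hb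
    rw [if_neg (hnot (y, i) (by simp [plaquette])),
      if_neg (hnot (y + unitVec i, j) (by simp [plaquette])),
      if_neg (hnot (y, j) (by simp [plaquette])),
      if_neg (hnot (y + unitVec j, i) (by simp [plaquette]))]

/-- `U` contains `x`, and the heights are positive along the inner boundary of `U` and
non-positive along its outer boundary. -/
def IsPositiveIsland (ψ : (Fin d → ℤ) → ℤ) (x : Fin d → ℤ) (U : Finset (Fin d → ℤ)) : Prop :=
  x ∈ U ∧ ∀ u ∈ U, ∀ v ∉ U, Adj u v → 1 ≤ ψ u ∧ ψ v ≤ 0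

theorem IsPositiveIsland.of_forall {ψ : (Fin d → ℤ) → ℤ} {x : Fin d → ℤ}
    {U V : Finset (Fin d → ℤ)} (hU : IsPositiveIsland ψ x U) (hx : x ∈ V)
    (h : ∀ u ∈ V, ∀ v ∉ V, Adj u v → u ∈ U ∧ v ∉ U) : IsPositiveIsland ψ x V :=
  ⟨hx, fun u hu v hv huv => hU.2 u (h u hu v hv huv).1 v (h u hu v hv huv).2 huv⟩

theorem edgeBoundary_adj {u v : Fin d → ℤ} (huv : Adj u v) :
    ∃ e : (Fin d → ℤ) × Fin d, ∀ V : Finset (Fin d → ℤ),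
      e ∈ edgeBoundary V ↔ ¬ (u ∈ V ↔ v ∈ V) := by
  obtain ⟨i, rfl | rfl⟩ := adj_iff.1 huv
  · exact ⟨(u, i), fun V => mem_edgeBoundary⟩
  · refine ⟨(v, i), fun V => mem_edgeBoundary.trans ?_⟩
    simp only
    tauto

/-- If an island of minimal boundary is the symmetric difference of two sets whose boundaries
are disjoint, then one of them is empty. -/
theorem eq_empty_of_minimal_island (hd : 0 < d) {ψ : (Fin d → ℤ) → ℤ} {x : Fin d → ℤ}
    {U G G' : Finset (Fin d → ℤ)} (hU : IsPositiveIsland ψ x U)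
    (hmin : ∀ V, IsPositiveIsland ψ x V → (edgeBoundary U).card ≤ (edgeBoundary V).card)
    (hdis : Disjoint (edgeBoundary G) (edgeBoundary G'))
    (hunion : edgeBoundary G ∪ edgeBoundary G' = edgeBoundary U)
    (hsymm : ∀ y, y ∈ U ↔ ¬ (y ∈ G ↔ y ∈ G')) (hx : x ∈ G) : G' = ∅ := by
  have hx' : x ∉ G' := by
    have := (hsymm x).1 hU.1
    tauto
  have hone : ∀ u v, Adj u v → (u ∈ G ↔ v ∈ G) ∨ (u ∈ G' ↔ v ∈ G') := by
    intro u v huv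
    obtain ⟨e, he⟩ := edgeBoundary_adj huv
    by_contra! hc
    refine disjoint_left.1 hdis ((he G).2 ?_) ((he G').2 ?_) <;> tauto
  -- Both the difference and the union are islands with boundary inside that of `U`, hence equal to
  -- it by minimality. An edge on the boundary of `G'` has both ends in `G` or both outside: the
  -- first is not a boundary edge of the union, the second not one of the difference.
  have hA : IsPositiveIsland ψ x (G \ G') := by
    refine hU.of_forall (mem_sdiff.2 ⟨hx, hx'⟩) fun u hu v hv huv => ?_
    have := hone u v huv
    rw [hsymm, hsymm]
    rw [mem_sdiff] at hu hv
    tauto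
  have hB : IsPositiveIsland ψ x (G ∪ G') := by
    refine hU.of_forall (mem_union_left _ hx) fun u hu v hv huv => ?_
    have := hone u v huv
    rw [hsymm, hsymm]
    rw [mem_union] at hu hv
    tauto
  have hsubA : edgeBoundary (G \ G') ⊆ edgeBoundary U := by
    rw [← hunion]
    intro e he
    simp only [mem_union, mem_edgeBoundary, mem_sdiff] at he ⊢
    tauto
  have hsubB : edgeBoundary (G ∪ G') ⊆ edgeBoundary U := by
    rw [← hunion]
    intro e he
    simp only [mem_union, mem_edgeBoundary] at he ⊢
    tauto
  have hAU := eq_of_subset_of_card_le hsubA (hmin _ hA)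
  have hBU := eq_of_subset_of_card_le hsubB (hmin _ hB)
  apply eq_empty_of_edgeBoundary_eq_empty hd
  rw [eq_empty_iff_forall_notMem]
  intro e he
  have h1 : e ∈ edgeBoundary U := hunion ▸ mem_union_right _ he
  have h2 := disjoint_right.1 hdis he
  have h3 : e ∈ edgeBoundary (G \ G') := hAU ▸ h1
  have h4 : e ∈ edgeBoundary (G ∪ G') := hBU ▸ h1
  simp only [mem_edgeBoundary, mem_sdiff, mem_union] at he h2 h3 h4
  tauto

/-- If the boundary split into two parts that no plaquette meets both, each part would bound a
finite set, and `U` would be their symmetric difference. Minimality leaves one of these sets empty.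
-/
theorem plaquetteConnected_of_minimal_island (hd : 2 ≤ d) {ψ : (Fin d → ℤ) → ℤ}
    {x : Fin d → ℤ} {U : Finset (Fin d → ℤ)} (hU : IsPositiveIsland ψ x U)
    (hmin : ∀ V, IsPositiveIsland ψ x V → (edgeBoundary U).card ≤ (edgeBoundary V).card) :
    PlaquetteConnected (edgeBoundary U) := by
  have hd0 : 0 < d := by omega
  intro E hE hne hne'
  by_contra! hcon
  have hsat : ∀ a ∈ E, ∀ b ∈ edgeBoundary U \ E, ∀ y i j,
      ¬ (a ∈ plaquette y i j ∧ b ∈ plaquette y i j) := fun a ha b hb y i j hab =>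
    hcon a ha b hb y i j hab.1 hab.2
  obtain ⟨G, hG⟩ := exists_edgeBoundary_eq_of_saturated hd hE hsat
  obtain ⟨G', hG'⟩ := exists_edgeBoundary_eq_of_saturated hd
    (sdiff_subset (s := edgeBoundary U) (t := E)) (fun a ha b hb y i j hab => by
      rw [Finset.sdiff_sdiff_eq_self hE] at hb
      exact hsat b hb a ha y i j hab.symm)
  have hdis : Disjoint (edgeBoundary G) (edgeBoundary G') := by
    rw [hG, hG']
    exact disjoint_sdiff
  have hunion : edgeBoundary G ∪ edgeBoundary G' = edgeBoundary U := by
    rw [hG, hG']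
    exact union_sdiff_of_subset hE
  have hsymmDiff : U = symmDiff G G' := by
    apply edgeBoundary_injective hd0
    ext e
    have h1 : e ∈ edgeBoundary G → e ∉ edgeBoundary G' := fun h => disjoint_left.1 hdis h
    rw [← hunion]
    simp only [mem_union, mem_edgeBoundary, mem_symmDiff] at h1 ⊢
    tauto
  have hsymm : ∀ y, y ∈ U ↔ ¬ (y ∈ G ↔ y ∈ G') := by
    intro y
    rw [hsymmDiff, mem_symmDiff]
    tauto
  have h0 : edgeBoundary (∅ : Finset (Fin d → ℤ)) = ∅ := by
    ext e
    simp [mem_edgeBoundary]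
  by_cases hx : x ∈ G
  · have := eq_empty_of_minimal_island hd0 hU hmin hdis hunion hsymm hx
    rw [this, h0] at hG'
    exact hne' (hE.antisymm (sdiff_eq_empty_iff_subset.1 hG'.symm))
  · have hx' : x ∈ G' := by
      have := (hsymm x).1 hU.1
      tauto
    have := eq_empty_of_minimal_island hd0 hU hmin hdis.symm (by rwa [union_comm])
      (fun y => (hsymm y).trans (by tauto)) hx'
    rw [this, h0] at hG
    exact hne.ne_empty hG.symm

end SOS

/-! ### Counting connected contours. -/

namespace SOS

open Finset

/-- An occurrence of `w` is replaced by `w, u, w`. Repeating this explores a connected set at a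
price of two steps per new vertex. -/
theorem exists_detour {V : Type*} {r : V → V → Prop} {w u : V} (hwu : r w u) (huw : r u w) {t : List V}
    {a : V} (h : (a :: t).IsChain r) (hw : w ∈ a :: t) :
    ∃ t' : List V, (a :: t').IsChain r ∧ t'.length = t.length + 2 ∧
      ∀ z, z ∈ a :: t' ↔ z = u ∨ z ∈ a :: t := by
  have hhere : ∀ s : List V, (w :: s).IsChain r → ∃ t' : List V, (w :: t').IsChain r ∧
      t'.length = s.length + 2 ∧ ∀ z, z ∈ w :: t' ↔ z = u ∨ z ∈ w :: s := by
    intro s hs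
    refine ⟨u :: w :: s, ?_, rfl, fun z => ?_⟩
    · rw [List.isChain_cons_cons, List.isChain_cons_cons]
      exact ⟨hwu, huw, hs⟩
    · simp only [List.mem_cons]
      tauto
  induction t generalizing a with
  | nil =>
    obtain rfl : w = a := by simpa using hw
    exact hhere _ h
  | cons b t ih =>
    rcases List.mem_cons.1 hw with rfl | hw'
    · exact hhere _ h
    · rw [List.isChain_cons_cons] at h
      obtain ⟨t', h1, h2, h3⟩ := ih h.2 hw'
      refine ⟨b :: t', List.isChain_cons_cons.2 ⟨h.1, h1⟩, by simp [h2], fun z => ?_⟩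
      rw [List.mem_cons, h3, List.mem_cons (l := b :: t)]
      tauto

section Chains

variable {V : Type*} [DecidableEq V] (nbr : V → Finset V)

/-- The lists of length `n` that continue `a` to a chain for the relation `b ∈ nbr a`. -/
def chainsFrom : ℕ → V → Finset (List V)
  | 0, _ => {[]}
  | n + 1, a => (nbr a).biUnion fun b => (chainsFrom n b).image fun t => b :: t

theorem card_chainsFrom_le {Δ : ℕ} (hΔ : ∀ a, (nbr a).card ≤ Δ) (n : ℕ) (a : V) :
    (chainsFrom nbr n a).card ≤ Δ ^ n := by
  induction n generalizing a with
  | zero => simp [chainsFrom]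
  | succ n ih =>
    calc (chainsFrom nbr (n + 1) a).card
        ≤ ∑ b ∈ nbr a, ((chainsFrom nbr n b).image fun t => b :: t).card := card_biUnion_le
      _ ≤ ∑ _b ∈ nbr a, Δ ^ n := sum_le_sum fun b _ => card_image_le.trans (ih b)
      _ ≤ Δ ^ (n + 1) := by
        rw [sum_const, smul_eq_mul, pow_succ, mul_comm]
        exact Nat.mul_le_mul_left _ (hΔ a)

theorem mem_chainsFrom {t : List V} {a : V} (h : (a :: t).IsChain fun a b => b ∈ nbr a) :
    t ∈ chainsFrom nbr t.length a := by
  induction t generalizing a with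
  | nil => simp [chainsFrom]
  | cons b t ih =>
    rw [List.isChain_cons_cons] at h
    exact mem_biUnion.2 ⟨b, h.1, mem_image_of_mem _ (ih h.2)⟩

/-- A connected set of `n` vertices is covered by a chain of length `2 (n - 1)`. -/
theorem exists_mem_chainsFrom {E : Finset V} {a : V} (ha : a ∈ E)
    (hE : ∀ E' ⊆ E, E'.Nonempty → E' ≠ E →
      ∃ w ∈ E', ∃ u ∈ E \ E', u ∈ nbr w ∧ w ∈ nbr u) :
    ∃ t ∈ chainsFrom nbr (2 * (E.card - 1)) a, (a :: t).toFinset = E := by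
  have key : ∀ n, n + 1 ≤ E.card → ∃ t : List V, (a :: t).IsChain (fun a b => b ∈ nbr a) ∧
      t.length = 2 * n ∧ (a :: t).toFinset ⊆ E ∧ (a :: t).toFinset.card = n + 1 := by
    intro n
    induction n with
    | zero =>
      intro _
      exact ⟨[], by simp, rfl, by simpa using ha, by simp⟩
    | succ n ih =>
      intro hn
      obtain ⟨t, h1, h2, h3, h4⟩ := ih (by omega)
      obtain ⟨w, hw, u, hu, huw, hwu⟩ := hE _ h3 ⟨a, by simp⟩ (fun hc => by
        rw [hc] at h4
        omega)
      rw [mem_sdiff] at hu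
      obtain ⟨t', h1', h2', h3'⟩ := exists_detour (r := fun a b => b ∈ nbr a) huw hwu h1
        (List.mem_toFinset.1 hw)
      have hset : (a :: t').toFinset = insert u (a :: t).toFinset := by
        ext z
        rw [List.mem_toFinset, h3', mem_insert, List.mem_toFinset]
      refine ⟨t', h1', by omega, ?_, ?_⟩
      · rw [hset]
        exact insert_subset hu.1 h3
      · rw [hset, card_insert_of_notMem hu.2, h4]
  have hpos : 0 < E.card := card_pos.2 ⟨a, ha⟩
  obtain ⟨t, h1, h2, h3, h4⟩ := key (E.card - 1) (by omega)
  refine ⟨t, h2 ▸ mem_chainsFrom nbr h1, eq_of_subset_of_card_le h3 ?_⟩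
  omega

end Chains

variable {d : ℕ}

/-- The edges that share a plaquette with a given edge. -/
def edgeNeighbours (e : (Fin d → ℤ) × Fin d) : Finset ((Fin d → ℤ) × Fin d) :=
  univ.biUnion fun j => (plaquette e.1 e.2 j ∪ plaquette (e.1 - unitVec j) j e.2) ∪
    (plaquette e.1 j e.2 ∪ plaquette (e.1 - unitVec j) e.2 j)

theorem card_plaquette_le (y : Fin d → ℤ) (i j : Fin d) : (plaquette y i j).card ≤ 4 :=
  card_le_four

theorem card_edgeNeighbours_le (e : (Fin d → ℤ) × Fin d) :
    (edgeNeighbours e).card ≤ 16 * d := by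
  refine (card_biUnion_le_card_mul _ _ 16 fun j _ => ?_).trans (by simp [mul_comm])
  refine (card_union_le _ _).trans ?_
  have h1 := card_union_le (plaquette e.1 e.2 j) (plaquette (e.1 - unitVec j) j e.2)
  have h2 := card_union_le (plaquette e.1 j e.2) (plaquette (e.1 - unitVec j) e.2 j)
  have h3 := card_plaquette_le e.1 e.2 j
  have h4 := card_plaquette_le (e.1 - unitVec j) j e.2
  have h5 := card_plaquette_le e.1 j e.2
  have h6 := card_plaquette_le (e.1 - unitVec j) e.2 j
  omega

theorem mem_edgeNeighbours {a b : (Fin d → ℤ) × Fin d} {y : Fin d → ℤ} {i j : Fin d}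
    (ha : a ∈ plaquette y i j) (hb : b ∈ plaquette y i j) : b ∈ edgeNeighbours a := by
  simp only [edgeNeighbours, mem_biUnion, mem_univ, true_and, mem_union]
  rw [plaquette] at ha
  simp only [mem_insert, mem_singleton] at ha
  rcases ha with rfl | rfl | rfl | rfl
  · exact ⟨j, Or.inl (Or.inl hb)⟩
  · exact ⟨i, Or.inl (Or.inr (by simpa only [add_sub_cancel_right] using hb))⟩
  · exact ⟨i, Or.inr (Or.inl hb)⟩
  · exact ⟨j, Or.inr (Or.inr (by simpa only [add_sub_cancel_right] using hb))⟩

/-- Follow the ray in the first direction from `x` until it exits after `k` further sites. From each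
of its `k + 1` sites in `U`, a ray in the second direction crosses a boundary edge, and these edges
are distinct. This limits the possible starting edges of a contour around `x`. -/
theorem exists_mem_edgeBoundary_of_mem (hd : 2 ≤ d) {U : Finset (Fin d → ℤ)} {x : Fin d → ℤ}
    (hx : x ∈ U) : ∃ k < (edgeBoundary U).card,
      (x + k • unitVec ⟨0, by omega⟩, ⟨0, by omega⟩) ∈ edgeBoundary U := by
  let o : Fin d := ⟨0, by omega⟩
  let p : Fin d := ⟨1, by omega⟩
  have hpo : p ≠ o := by simp [p, o, Fin.ext_iff]
  obtain ⟨k, hk, hk'⟩ := exists_exit hx (unitVec_apply_ne_zero o)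
  refine ⟨k, ?_, exit_mem_edgeBoundary (hk k le_rfl) hk'⟩
  have hex : ∀ j : ℕ, ∃ m : ℕ, j ≤ k →
      (x + j • unitVec o + m • unitVec p, p) ∈ edgeBoundary U := by
    intro j
    by_cases hj : j ≤ k
    · obtain ⟨m, hm, hm'⟩ := exists_exit (hk j hj) (unitVec_apply_ne_zero p)
      exact ⟨m, fun _ => exit_mem_edgeBoundary (hm m le_rfl) hm'⟩
    · exact ⟨0, fun h => absurd h hj⟩
  choose m hm using hex
  have hcard : (range (k + 1)).card ≤ (edgeBoundary U).card := by
    refine card_le_card_of_injOn (fun j => (x + j • unitVec o + m j • unitVec p, p))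
      (fun j hj => hm j (by simpa [Nat.lt_succ_iff] using hj)) fun j _ l _ hjl => ?_
    have := congrFun (congrArg Prod.fst hjl) o
    simpa [unitVec, Pi.single_eq_of_ne hpo.symm] using this
  rwa [card_range] at hcard

/-- The boundary determines the set, and is itself determined by one of `ℓ` starting edges together
with a covering chain of length `2 * (ℓ - 1)`. -/
theorem card_contours_le (hd : 2 ≤ d) {x : Fin d → ℤ} {ℓ : ℕ}
    (S : Finset (Finset (Fin d → ℤ))) (hS : ∀ U ∈ S, x ∈ U ∧
      PlaquetteConnected (edgeBoundary U) ∧ (edgeBoundary U).card = ℓ) :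
    S.card ≤ ℓ * (16 * d) ^ (2 * (ℓ - 1)) := by
  let o : Fin d := ⟨0, by omega⟩
  calc S.card = (S.image edgeBoundary).card :=
        (card_image_of_injective S (edgeBoundary_injective (by omega))).symm
    _ ≤ ((range ℓ).biUnion fun k => (chainsFrom edgeNeighbours (2 * (ℓ - 1))
          (x + k • unitVec o, o)).image fun t => ((x + k • unitVec o, o) :: t).toFinset).card := by
        refine card_le_card fun E hE => ?_
        obtain ⟨U, hU, rfl⟩ := mem_image.1 hE
        obtain ⟨hx, hconn, hcard⟩ := hS U hU
        obtain ⟨k, hk, hmem⟩ := exists_mem_edgeBoundary_of_mem hd hx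
        obtain ⟨t, ht, htE⟩ := exists_mem_chainsFrom edgeNeighbours hmem fun E' h1 h2 h3 => by
          obtain ⟨a, ha, b, hb, y, i, j, hay, hby⟩ := hconn E' h1 h2 h3
          exact ⟨a, ha, b, hb, mem_edgeNeighbours hay hby, mem_edgeNeighbours hby hay⟩
        rw [hcard] at ht hk
        exact mem_biUnion.2 ⟨k, mem_range.2 hk, mem_image.2 ⟨t, ht, htE⟩⟩
    _ ≤ (range ℓ).card * (16 * d) ^ (2 * (ℓ - 1)) :=
        card_biUnion_le_card_mul _ _ _ fun k _ =>
          card_image_le.trans (card_chainsFrom_le _ card_edgeNeighbours_le _ _)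
    _ = _ := by rw [card_range]

theorem sum_exp_contours_le (hd : 2 ≤ d) {x : Fin d → ℤ} {β : ℝ}
    (hβ : Real.log (16 * (16 * d) ^ 2) ≤ β) (S : Finset (Finset (Fin d → ℤ)))
    (hS : ∀ U ∈ S, x ∈ U ∧ PlaquetteConnected (edgeBoundary U)) :
    ∑ U ∈ S, Real.exp (-β * (edgeBoundary U).card) ≤ 1 / 4 := by
  have hd' : (1 : ℝ) ≤ 16 * d := by
    have : (2 : ℝ) ≤ d := by exact_mod_cast hd
    linarith
  set D : ℝ := (16 * d) ^ 2 with hD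
  have hD1 : 1 ≤ D := one_le_pow₀ hd'
  have hexp : D * Real.exp (-β) ≤ 1 / 16 := by
    have : 16 * D ≤ Real.exp β := (Real.log_le_iff_le_exp (by positivity)).1 hβ
    rw [Real.exp_neg, ← div_eq_mul_inv, div_le_iff₀ (Real.exp_pos β)]
    linarith
  -- Since `1 ≤ D`, the exponent `ℓ - 1` may be raised to `ℓ`; the truncated subtraction at `ℓ = 0`
  -- is harmless because of the factor `ℓ`. The resulting series has sum `16 / 225`.
  have hterm : ∀ ℓ : ℕ, ((ℓ * (16 * d) ^ (2 * (ℓ - 1)) : ℕ) : ℝ) * Real.exp (-β * ℓ)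
      ≤ ℓ * (1 / 16) ^ ℓ := by
    intro ℓ
    push_cast
    rw [pow_mul, ← hD, mul_assoc, mul_comm (-β), Real.exp_nat_mul]
    refine mul_le_mul_of_nonneg_left ?_ (by positivity)
    calc D ^ (ℓ - 1) * Real.exp (-β) ^ ℓ ≤ D ^ ℓ * Real.exp (-β) ^ ℓ := by
          gcongr
          omega
      _ = (D * Real.exp (-β)) ^ ℓ := (mul_pow _ _ _).symm
      _ ≤ _ := by gcongr
  have hnorm : ‖(1 / 16 : ℝ)‖ < 1 := by norm_num
  have hsum := hasSum_coe_mul_geometric_of_norm_lt_one hnorm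
  calc ∑ U ∈ S, Real.exp (-β * (edgeBoundary U).card)
      = ∑ ℓ ∈ S.image (fun U => (edgeBoundary U).card),
          ∑ U ∈ S.filter (fun U => (edgeBoundary U).card = ℓ),
            Real.exp (-β * (edgeBoundary U).card) :=
        (sum_fiberwise_of_maps_to (fun U hU => mem_image_of_mem _ hU) _).symm
    _ ≤ ∑ ℓ ∈ S.image (fun U => (edgeBoundary U).card), (ℓ : ℝ) * (1 / 16) ^ ℓ := by
        refine sum_le_sum fun ℓ _ => ?_
        rw [sum_congr rfl fun U hU => by rw [(mem_filter.1 hU).2], sum_const, nsmul_eq_mul]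
        refine le_trans (mul_le_mul_of_nonneg_right ?_ (Real.exp_pos _).le) (hterm ℓ)
        exact_mod_cast card_contours_le hd _ fun U hU =>
          ⟨(hS U (mem_filter.1 hU).1).1, (hS U (mem_filter.1 hU).1).2, (mem_filter.1 hU).2⟩
    _ ≤ ∑' ℓ : ℕ, (ℓ : ℝ) * (1 / 16) ^ ℓ :=
        hsum.summable.sum_le_tsum _ fun _ _ => by positivity
    _ ≤ 1 / 4 := by
        rw [hsum.tsum_eq]
        norm_num

/-! ### The Peierls estimate and tightness at low temperature. -/

theorem exists_minimal_positiveIsland {Λ : Finset (Fin d → ℤ)} (φ : Λ → ℤ) {x : Fin d → ℤ}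
    (hx : 1 ≤ extend φ x) : ∃ U, IsPositiveIsland (extend φ) x U ∧
      ∀ V, IsPositiveIsland (extend φ) x V → (edgeBoundary U).card ≤ (edgeBoundary V).card := by
  have hmem : ∀ y, y ∈ Λ.filter (fun y => 1 ≤ extend φ y) ↔ 1 ≤ extend φ y := by
    intro y
    rw [mem_filter, and_iff_right_iff_imp]
    intro hy
    by_contra hc
    rw [extend_of_notMem φ hc] at hy
    omega
  have hex : ∃ U, IsPositiveIsland (extend φ) x U := by
    refine ⟨Λ.filter fun y => 1 ≤ extend φ y, (hmem x).2 hx, fun u hu v hv _ => ?_⟩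
    rw [hmem] at hu hv
    omega
  obtain ⟨U, hU, hmin⟩ := (measure fun U : Finset (Fin d → ℤ) =>
    (edgeBoundary U).card).wf.has_min {U | IsPositiveIsland (extend φ) x U} hex
  exact ⟨U, hU, fun V hV => not_lt.1 (hmin V hV)⟩

/-- Outside the box heights are zero, so an island site there has all its neighbours in the island.
Moving outwards along a coordinate where the site lies outside the box would then never leave this
finite set. -/
theorem IsPositiveIsland.subset_box {N : ℕ} {φ : box d N → ℤ} {x : Fin d → ℤ}
    {U : Finset (Fin d → ℤ)} (hU : IsPositiveIsland (extend φ) x U) : U ⊆ box d N := by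
  intro u hu
  by_contra hbox
  have hout : ∀ y : Fin d → ℤ, y ∉ box d N → ∀ v, Adj y v → y ∈ U → v ∈ U := by
    intro y hy v hyv hyU
    by_contra hv
    have := (hU.2 y hyU v hv hyv).1
    rw [extend_of_notMem φ hy] at this
    omega
  rw [mem_box] at hbox
  push Not at hbox
  obtain ⟨i, hi⟩ := hbox
  rcases lt_or_ge (u i) 1 with h1 | h1
  · have hne : (-unitVec i : Fin d → ℤ) i ≠ 0 := by simp [unitVec]
    obtain ⟨m, hm, hm'⟩ := exists_exit hu hne
    apply hm'
    rw [add_smul, one_smul, ← add_assoc]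
    refine hout _ (fun hc => ?_) _ ?_ (hm m le_rfl)
    · have := (mem_box.1 hc i).1
      simp [unitVec] at this
      omega
    · have := adj_symm (adj_add_unitVec (u + m • -unitVec i + -unitVec i) i)
      rwa [neg_add_cancel_right] at this
  · have h2 := hi h1
    obtain ⟨m, hm, hm'⟩ := exists_exit hu (unitVec_apply_ne_zero i)
    apply hm'
    rw [add_smul, one_smul, ← add_assoc]
    refine hout _ (fun hc => ?_) _ (adj_add_unitVec _ i) (hm m le_rfl)
    have := (mem_box.1 hc i).2
    simp [unitVec] at this
    omega

/-- The configuration `φ` lowered by one on `U`. -/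
def lower {Λ : Finset (Fin d → ℤ)} (U : Finset (Fin d → ℤ)) : (Λ → ℤ) ≃ (Λ → ℤ) :=
  Equiv.subRight fun x => if x.1 ∈ U then 1 else 0

theorem extend_lower {Λ U : Finset (Fin d → ℤ)} (hU : U ⊆ Λ) (φ : Λ → ℤ) (y : Fin d → ℤ) :
    extend (lower U φ) y = extend φ y - if y ∈ U then 1 else 0 := by
  by_cases hy : y ∈ Λ
  · rw [extend_apply _ (⟨y, hy⟩ : Λ), extend_apply _ (⟨y, hy⟩ : Λ)]
    rfl
  · rw [extend_of_notMem _ hy, extend_of_notMem _ hy, if_neg fun h => hy (hU h), sub_zero]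

/-- On a boundary edge the inner height is at least one and the outer at most zero, so the gradient
drops by exactly one. All other gradients are unchanged. -/
theorem hamiltonian_lower_add_card_le {Λ U : Finset (Fin d → ℤ)} {φ : Λ → ℤ} {x : Fin d → ℤ}
    (hUΛ : U ⊆ Λ) (hU : IsPositiveIsland (extend φ) x U) :
    hamiltonian Λ 0 (lower U φ) + (edgeBoundary U).card ≤ hamiltonian Λ 0 φ := by
  set B := Λ ∪ boundary Λ with hB
  have hsub : edgeBoundary U ⊆ B ×ˢ univ := by
    intro e he
    refine mem_product.2 ⟨?_, mem_univ _⟩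
    rw [mem_edgeBoundary] at he
    by_cases h : e.1 ∈ U
    · exact mem_union_left _ (hUΛ h)
    · have h' : e.1 + unitVec e.2 ∈ U := by tauto
      simpa using sub_unitVec_mem (B := B) subset_rfl (hUΛ h') e.2
  have hcard : ((edgeBoundary U).card : ℝ)
      = ∑ e ∈ B ×ˢ univ, if e ∈ edgeBoundary U then (1 : ℝ) else 0 := by
    rw [sum_boole, filter_mem_eq_inter, inter_eq_right.2 hsub]
  rw [hamiltonian_eq_sum (B := B) subset_rfl, hamiltonian_eq_sum (B := B) subset_rfl,
    ← sum_product', ← sum_product', hcard, ← sum_add_distrib]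
  refine sum_le_sum fun e _ => ?_
  obtain ⟨y, i⟩ := e
  simp only [mem_edgeBoundary, extend_lower hUΛ]
  have hadj := adj_add_unitVec y i
  by_cases h1 : y ∈ U <;> by_cases h2 : y + unitVec i ∈ U
  · simp [h1, h2]
  · obtain ⟨h3, h4⟩ := hU.2 y h1 _ h2 hadj
    have h3' : (1 : ℝ) ≤ extend φ y := by exact_mod_cast h3
    have h4' : (extend φ (y + unitVec i) : ℝ) ≤ 0 := by exact_mod_cast h4
    simp only [h1, h2, if_true, if_false, not_false_eq_true, iff_false, not_true]
    push_cast
    rw [abs_of_nonpos (by linarith), abs_of_nonpos (by linarith)]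
    linarith
  · obtain ⟨h3, h4⟩ := hU.2 _ h2 y h1 (adj_symm hadj)
    have h3' : (1 : ℝ) ≤ extend φ (y + unitVec i) := by exact_mod_cast h3
    have h4' : (extend φ y : ℝ) ≤ 0 := by exact_mod_cast h4
    simp only [h1, h2, if_true, if_false, not_false_eq_true, iff_true]
    push_cast
    rw [abs_of_nonneg (by linarith), abs_of_nonneg (by linarith)]
    linarith
  · simp [h1, h2]

/-- The Peierls estimate for the probability of a positive height. -/
theorem tsum_pos_height_le (hd : 2 ≤ d) {β : ℝ} (hβ0 : 0 < β)
    (hβ : Real.log (16 * (16 * d) ^ 2) ≤ β) (N : ℕ) (x : Fin d → ℤ) :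
    ∑' φ : box d N → ℤ, (if 1 ≤ extend φ x then (1 : ℝ) else 0)
        * Real.exp (-β * hamiltonian (box d N) 0 φ)
      ≤ 1 / 4 * partitionSOS (box d N) β 0 := by
  classical
  have hd0 : 0 < d := by omega
  set Λ := box d N with hΛ
  set S := Λ.powerset.filter fun U => x ∈ U ∧ PlaquetteConnected (edgeBoundary U) with hS
  have hs := summable_exp_hamiltonian Λ hβ0 hd0 0
  have hsum : ∀ U ∈ S, Summable fun φ : Λ → ℤ => Real.exp (-β * (edgeBoundary U).card)
      * Real.exp (-β * hamiltonian Λ 0 (lower U φ)) := fun U _ =>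
    ((lower U).summable_iff.2 hs).mul_left _
  -- A union bound over possible islands; since lowering on a fixed `U` is a bijection of
  -- configurations, summing over `φ` restores the full partition function for each `U`.
  have hle : ∀ φ : Λ → ℤ, (if 1 ≤ extend φ x then (1 : ℝ) else 0)
        * Real.exp (-β * hamiltonian Λ 0 φ)
      ≤ ∑ U ∈ S, Real.exp (-β * (edgeBoundary U).card)
        * Real.exp (-β * hamiltonian Λ 0 (lower U φ)) := by
    intro φ
    split_ifs with hx
    · obtain ⟨U, hU, hmin⟩ := exists_minimal_positiveIsland φ hx
      have hUS : U ∈ S := mem_filter.2 ⟨mem_powerset.2 hU.subset_box, hU.1,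
        plaquetteConnected_of_minimal_island hd hU hmin⟩
      refine le_trans ?_ (single_le_sum (f := fun U => Real.exp (-β * (edgeBoundary U).card)
        * Real.exp (-β * hamiltonian Λ 0 (lower U φ))) (fun _ _ => by positivity) hUS)
      rw [one_mul, ← Real.exp_add]
      apply Real.exp_le_exp.2
      have := mul_le_mul_of_nonneg_left (hamiltonian_lower_add_card_le hU.subset_box hU) hβ0.le
      linarith
    · rw [zero_mul]
      exact sum_nonneg fun _ _ => by positivity
  calc _ ≤ ∑' φ : Λ → ℤ, ∑ U ∈ S, Real.exp (-β * (edgeBoundary U).card)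
        * Real.exp (-β * hamiltonian Λ 0 (lower U φ)) :=
        Summable.tsum_le_tsum hle (summable_mul_exp_hamiltonian Λ hβ0 hd0 0 (M := 1)
          fun φ => by split_ifs <;> simp) (summable_sum hsum)
    _ = ∑ U ∈ S, Real.exp (-β * (edgeBoundary U).card) * partitionSOS Λ β 0 := by
        rw [Summable.tsum_finsetSum hsum]
        refine sum_congr rfl fun U _ => ?_
        rw [tsum_mul_left, (lower U).tsum_eq fun φ => Real.exp (-β * hamiltonian Λ 0 φ),
          partitionSOS]
    _ ≤ _ := by
        rw [← sum_mul]
        exact mul_le_mul_of_nonneg_right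
          (sum_exp_contours_le hd hβ S fun U hU => (mem_filter.1 hU).2)
          (partitionSOS_pos Λ hβ0 hd0 0).le

/-- By the symmetry `φ ↦ -φ`, positive and negative heights each have probability at most `1 / 4`,
so the height is zero with probability at least `1 / 2`, at every site. -/
theorem isTight_of_large (hd : 2 ≤ d) {β : ℝ} (hβ0 : 0 < β)
    (hβ : Real.log (16 * (16 * d) ^ 2) ≤ β) : IsTight d β := by
  have hd0 : 0 < d := by omega
  refine ⟨0, 0, 1 / 2, by norm_num, fun N x _ => ?_⟩
  set Λ := box d N with hΛ
  set P : (Λ → ℤ) → ℝ := fun φ => if 1 ≤ extend φ x then 1 else 0 with hP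
  have hPb : ∀ φ, |P φ| ≤ 1 := fun φ => by
    simp only [hP]
    split_ifs <;> simp
  have hneg : ∀ φ : Λ → ℤ, extend (-φ) x = - extend φ x := by
    intro φ
    by_cases h : x ∈ Λ <;> simp [extend, h]
  have hpos := tsum_pos_height_le hd hβ0 hβ N x
  have hsymm : ∑' φ : Λ → ℤ, P (-φ) * Real.exp (-β * hamiltonian Λ 0 φ)
      = ∑' φ : Λ → ℤ, P φ * Real.exp (-β * hamiltonian Λ 0 φ) := by
    rw [← (Equiv.neg (Λ → ℤ)).tsum_eq]
    refine tsum_congr fun φ => ?_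
    rw [Equiv.neg_apply, neg_neg, hamiltonian_neg]
  have hZ := partitionSOS_pos Λ hβ0 hd0 0
  have hs0 := summable_mul_exp_hamiltonian Λ hβ0 hd0 0
    (F := fun φ => heightIndicator 0 x (extend φ)) fun φ => abs_heightIndicator_le 0 x _
  have hs1 := summable_mul_exp_hamiltonian Λ hβ0 hd0 0 hPb
  have hs2 := summable_mul_exp_hamiltonian Λ hβ0 hd0 0 (F := fun φ => P (-φ)) fun φ => hPb _
  have hsplit : partitionSOS Λ β 0
      = ∑' φ : Λ → ℤ, heightIndicator 0 x (extend φ) * Real.exp (-β * hamiltonian Λ 0 φ)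
        + (∑' φ : Λ → ℤ, P φ * Real.exp (-β * hamiltonian Λ 0 φ)
          + ∑' φ : Λ → ℤ, P (-φ) * Real.exp (-β * hamiltonian Λ 0 φ)) := by
    rw [← hs1.tsum_add hs2, ← hs0.tsum_add (hs1.add hs2), partitionSOS]
    refine tsum_congr fun φ => ?_
    rw [← add_mul, ← add_mul]
    have : heightIndicator 0 x (extend φ) + (P φ + P (-φ)) = 1 := by
      simp only [heightIndicator, hP, hneg, Nat.cast_zero, abs_nonpos_iff]
      rcases lt_trichotomy (extend φ x) 0 with h | h | h
      · rw [if_neg (by omega), if_neg (by omega), if_pos (by omega)]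
        norm_num
      · rw [if_pos (by omega), if_neg (by omega), if_neg (by omega)]
        norm_num
      · rw [if_neg (by omega), if_pos (by omega), if_neg (by omega)]
        norm_num
    rw [this, one_mul]
  rw [expectation, le_div_iff₀ hZ]
  linarith

end SOS

theorem proposition2p3 (d : ℕ) (hd : 2 ≤ d) :
    ∃ b : ℝ, 0 < b ∧ ∀ β : ℝ,
      (b ≤ β ∨ ∃ β₀ : ℝ, SOS.IsRigidityThreshold d β₀ ∧ β₀ ≤ β) →
        -- the limits that define the free energies exist, for every boundary condition
        (∀ n : ℤ, Filter.Tendsto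
          (fun N : ℕ => Real.log (SOS.partitionSOS (SOS.box d N) β n) / (N : ℝ) ^ d)
          Filter.atTop (nhds (SOS.freeEnergySOS d β))) ∧
        (∀ (n : ℤ) (h : ℝ), Filter.Tendsto
          (fun N : ℕ => Real.log (SOS.partition (SOS.box d N) β n h) / (N : ℝ) ^ d)
          Filter.atTop (nhds (SOS.freeEnergy d β h))) ∧
        -- the critical point
        SOS.criticalPoint d β = 0 ∧
        -- linear behaviour at the right of the critical point
        (∃ c : ℝ, 0 < c ∧ Asymptotics.IsEquivalent (nhdsWithin 0 (Set.Ioi 0))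
          (fun h : ℝ => SOS.reducedFreeEnergy d β h) (fun h : ℝ => c * h)) ∧
        -- the transition is of first order
        ¬ DifferentiableAt ℝ (fun h : ℝ => SOS.reducedFreeEnergy d β h) 0 := by
  have hd0 : 0 < d := by omega
  have hb : 0 < Real.log (16 * (16 * d) ^ 2) := by
    apply Real.log_pos
    have : (2 : ℝ) ≤ d := by exact_mod_cast hd
    nlinarith
  -- An edge has at most `16 * d` plaquette neighbours and a covering chain takes about two steps
  -- per edge. This choice makes the entropy factor times `exp (-β)` at most `1 / 16` per contour
  -- edge.
  refine ⟨Real.log (16 * (16 * d) ^ 2), hb, fun β hβ => ?_⟩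
  have hβ0 : 0 < β := by
    rcases hβ with hβ | ⟨β₀, hrig, hβ⟩
    · exact hb.trans_le hβ
    · exact hrig.1.trans_le hβ
  have htight : SOS.IsTight d β := by
    rcases hβ with hβ | ⟨β₀, hrig, hβ⟩
    · exact SOS.isTight_of_large hd hβ0 hβ
    · exact hrig.isTight hd0 hβ
  obtain ⟨κ, hκ, hκF⟩ := htight.exists_mul_le hd0 hβ0
  exact ⟨SOS.tendsto_log_partitionSOS hd0 hβ0, SOS.tendsto_log_partition hd0 hβ0,
    SOS.criticalPoint_eq_zero hd0 hβ0 hκ hκF,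
    SOS.exists_isEquivalent_of_mul_le
      (fun h _ t ht => SOS.reducedFreeEnergy_mul_le hd0 hβ0 h ht) hκ hκF,
    SOS.not_differentiableAt_of_mul_le
      (fun h hh => SOS.reducedFreeEnergy_of_nonpos hd0 hβ0 hh) hκ hκF⟩
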